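/- Let $L\ge 1$ be an integer, let $\Lambda=(\mathbb{Z}/L\mathbb{Z})^2$ be the $L\times L$ square lattice with periodic boundary conditions and primitive translations $\vec e_1,\vec e_2$, with one spin-$1/2$ on each site, and consider the Hamiltonian $$H=\sum_{\vec r\in\Lambda}\Bigl(J^1 Z_{\vec r}Z_{\vec r+\vec e_1}+J^2 Z_{\vec r}Z_{\vec r+\vec e_2}+h^xX_{\vec r}+h^zZ_{\vec r}\Bigr),$$ with real $J^1,J^2,h^x,h^z$, where $X_{\vec r},Y_{\vec r},Z_{\vec r}$ are the Pauli operators on site $\vec r$. A Pauli product is a tensor product over all sites of operators from $\{I,X,Y,Z\}$; it is an $(\ell_1,\ell_2)$-support operator if the smallest rectangle $\{r_1,\dots,r_1+\ell_1-1\}\times\{r_2,\dots,r_2+\ell_2-1\}$ (coordinates modulo $L$) containing all sites on which it is not the identity has side lengths $\ell_1,\ell_2$. An operator $Q$ is a $(k_1,k_2)$-local conserved quantity if $[Q,H]=0$ and, for each $\mu\in\{1,2\}$, $k_\mu$ is the maximum of the side lengths $\ell_\mu$ of the Pauli products that have a nonzero coefficient in the expansion of $Q$ in Pauli products. Theorem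 1. Assume $J^1\neq0$, $J^2\neq 0$ and $h^x\neq0$, with $h^z\in\mathbb{R}$ arbitrary (possibly $0$). If $3\le k_1\le L/2$ and $k_2$ is arbitrary, then there are no $(k_1,k_2)$-local conserved quantities. -/

import Mathlib

namespace IsingSquare

/-- Labels of the four single-site operators `I`, `X`, `Y`, `Z`. -/
inductive Pauli where
  | I | X | Y | Z
  deriving DecidableEq

instance : Fintype Pauli where
  elems := {.I, .X, .Y, .Z}
  complete := by intro P; cases P <;> decide

/-- The `2 × 2` matrix of a single-site operator (identity or Pauli matrix). -/
noncomputable def pauliMatrix : Pauli → Matrix (Fin 2) (Fin 2) ℂ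
  | .I => !![1, 0; 0, 1]
  | .X => !![0, 1; 1, 0]
  | .Y => !![0, -Complex.I; Complex.I, 0]
  | .Z => !![1, 0; 0, -1]

/-- The `L × L` square lattice with periodic boundary conditions. -/
abbrev Site (L : ℕ) : Type := ZMod L × ZMod L

/-- Primitive translation in direction 1. -/
def e₁ (L : ℕ) : Site L := (1, 0)

/-- Primitive translation in direction 2. -/
def e₂ (L : ℕ) : Site L := (0, 1)

/-- Operators on the Hilbert space `⨂_{r} ℂ²` of one spin-1/2 per site, as matrices in the
product basis, which is indexed by the spin configurations `Site L → Fin 2`. -/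
abbrev Operator (L : ℕ) : Type := Matrix (Site L → Fin 2) (Site L → Fin 2) ℂ

/-- A choice of one of `I, X, Y, Z` at every site. -/
abbrev PauliProduct (L : ℕ) : Type := Site L → Pauli

/-- The operator `⨂_{r} A_r` described by a Pauli product. -/
noncomputable def PauliProduct.toOperator {L : ℕ} [NeZero L] (A : PauliProduct L) : Operator L :=
  Matrix.of fun s t => ∏ r, pauliMatrix (A r) (s r) (t r)

/-- The operator `P_r` that acts as `P` on site `r` and as the identity on all other sites. -/
noncomputable def siteOp {L : ℕ} [NeZero L] (P : Pauli) (r : Site L) : Operator L :=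
  PauliProduct.toOperator (Function.update (fun _ => .I) r P)

/-- The Hamiltonian
`H = ∑_r (J¹ Z_r Z_{r+e₁} + J² Z_r Z_{r+e₂} + hˣ X_r + hᶻ Z_r)`. -/
noncomputable def hamiltonian (L : ℕ) [NeZero L] (J₁ J₂ hx hz : ℝ) : Operator L :=
  ∑ r : Site L,
    ((J₁ : ℂ) • (siteOp .Z r * siteOp .Z (r + e₁ L))
      + (J₂ : ℂ) • (siteOp .Z r * siteOp .Z (r + e₂ L))
      + (hx : ℂ) • siteOp .X r
      + (hz : ℂ) • siteOp .Z r)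

/-- The support of a Pauli product: the sites on which it is not the identity. -/
def PauliProduct.support {L : ℕ} (A : PauliProduct L) : Set (Site L) :=
  {p | A p ≠ Pauli.I}

/-- The rectangle `{r₁, …, r₁ + ℓ₁ - 1} × {r₂, …, r₂ + ℓ₂ - 1}` on the periodic lattice. -/
def rectangle {L : ℕ} (r : Site L) (ℓ₁ ℓ₂ : ℕ) : Set (Site L) :=
  {p | (∃ i < ℓ₁, p.1 = r.1 + (i : ZMod L)) ∧ (∃ j < ℓ₂, p.2 = r.2 + (j : ZMod L))}

/-- `A` is an `(ℓ₁, ℓ₂)`-support Pauli product: the smallest rectangle that contains its support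
has side lengths `ℓ₁` and `ℓ₂`. (The identity has side lengths `0` and `0`.) -/
def PauliProduct.HasSupportSize {L : ℕ} (A : PauliProduct L) (ℓ₁ ℓ₂ : ℕ) : Prop :=
  (∃ r, A.support ⊆ rectangle r ℓ₁ ℓ₂) ∧
    ∀ r m₁ m₂, A.support ⊆ rectangle r m₁ m₂ → ℓ₁ ≤ m₁ ∧ ℓ₂ ≤ m₂

/-- `Q` is a `(k₁, k₂)`-local operator: in its expansion in Pauli products, the maximal side
lengths in directions 1 and 2 of the Pauli products with nonzero coefficient are `k₁` and `k₂`. -/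
def IsLocalOperator {L : ℕ} [NeZero L] (k₁ k₂ : ℕ) (Q : Operator L) : Prop :=
  ∃ c : PauliProduct L → ℂ,
    Q = ∑ A, c A • A.toOperator ∧
    IsGreatest {ℓ₁ | ∃ A ℓ₂, c A ≠ 0 ∧ A.HasSupportSize ℓ₁ ℓ₂} k₁ ∧
    IsGreatest {ℓ₂ | ∃ A ℓ₁, c A ≠ 0 ∧ A.HasSupportSize ℓ₁ ℓ₂} k₂

/-- `Q` is a `(k₁, k₂)`-local conserved quantity of the Hamiltonian `H`. -/
def IsLocalConservedQuantity {L : ℕ} [NeZero L] (H : Operator L) (k₁ k₂ : ℕ) (Q : Operator L) : Prop :=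
  Commute Q H ∧ IsLocalOperator k₁ k₂ Q

end IsingSquare

/-! Write `Q = ∑ A, c A • A`. Since Pauli products are linearly independent, `[Q, H] = 0` is a
linear system with one equation for each product `B`: the signed sum of `c (act T B)` over the terms
`T` of `H` that anticommute with `B` vanishes (`sum_eq_zero_of_commute`). Put `k₁ = m + 2`. It
suffices that `c A = 0` whenever columns `x` and `x + m + 1` of `A` are both occupied
(`eq_zero_of_occupied`), because a product attaining the width `k₁` is of this kind.

Shape. Extending such an `A` by a bond beyond one end gives a `B` that is too wide, so any other
contributing term must remove the opposite end column. Only a bond in direction 1 can do so, and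
only if that column is a single `Z` (`exists_of_not_occupied_act`). Together with the transverse
field, which turns an end `Z` into `Y` and back, this slides `A` along the lattice one column at a
time and forces it to be a chain with interior `X ⋯ X` in one row (`eq_chain_of_shift`). The
condition `k₁ ≤ L / 2` keeps the two ends from meeting around the torus.

Elimination. So far the situation is that of the Ising chain in one dimension, and the remaining
coefficients are translation invariant along the row. The second dimension enters by attaching a
vertical bond to one column of a chain. The resulting `Z` in the neighbouring row can be removed by
no term but that bond if the result is to be a chain again. The equations of these decorated chains
telescope as the chain slides under the fixed bond, and their `J₂` contributions add up instead of
cancelling. This gives `2 (m + 1) J₂ c = 0` for chains `Y X ⋯ X Z` (`chain_YZ_eq_zero`), and then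
`(2 m + 1) J₂ hx c = 0` for chains `Z X ⋯ X Z` (`chain_ZZ_eq_zero`), the only ones left. -/

namespace IsingSquare

/-! ### Pauli labels up to phase, and the terms of the Hamiltonian -/

namespace Pauli

/-- The product of two single-site operators up to a phase. -/
def mul : Pauli → Pauli → Pauli
  | .I, q => q
  | p, .I => p
  | .X, .X => .I
  | .Y, .Y => .I
  | .Z, .Z => .I
  | .X, .Y => .Z
  | .Y, .X => .Z
  | .X, .Z => .Y
  | .Z, .X => .Y
  | .Y, .Z => .X
  | .Z, .Y => .X

theorem mul_mul_cancel (p q : Pauli) : mul p (mul p q) = q := by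
  cases p <;> cases q <;> rfl

theorem mul_left_comm (p q r : Pauli) : mul p (mul q r) = mul q (mul p r) := by
  cases p <;> cases q <;> cases r <;> rfl

@[simp] theorem I_mul (p : Pauli) : mul .I p = p := by cases p <;> rfl

/-- The operator anticommutes with `Z`. -/
def FlipsZ (p : Pauli) : Prop := p = .X ∨ p = .Y

@[simp] theorem flipsZ_X : FlipsZ .X := Or.inl rfl
@[simp] theorem flipsZ_Y : FlipsZ .Y := Or.inr rfl
@[simp] theorem not_flipsZ_I : ¬ FlipsZ .I := by simp [FlipsZ]
@[simp] theorem not_flipsZ_Z : ¬ FlipsZ .Z := by simp [FlipsZ]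

theorem FlipsZ.ne_I {p : Pauli} (h : FlipsZ p) : p ≠ .I := by rintro rfl; simp at h

theorem FlipsZ.mul_Z {p : Pauli} (h : FlipsZ p) : FlipsZ (mul .Z p) := by
  cases p <;> simp_all [mul]

/-- The sign in `[Z, Z P] = 2 i s P`. -/
def sgnZ : Pauli → ℤ
  | .I => 0 | .X => -1 | .Y => 1 | .Z => 0

/-- The sign in `[X, X P] = 2 i s P`. -/
def sgnX : Pauli → ℤ
  | .I => 0 | .X => 0 | .Y => -1 | .Z => 1

/-- The sign in `[Z Z, Z P ⊗ Z Q] = 2 i s P ⊗ Q`. -/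
def sgnZZ : Pauli → Pauli → ℤ
  | .I, q => sgnZ q
  | .Z, q => sgnZ q
  | p, .I => sgnZ p
  | p, .Z => sgnZ p
  | _, _ => 0

end Pauli

/-- The four kinds of terms of the Hamiltonian. -/
inductive TermKind where
  | hbond | vbond | xfield | zfield
  deriving DecidableEq

instance : Fintype TermKind where
  elems := {.hbond, .vbond, .xfield, .zfield}
  complete := by intro P; cases P <;> decide

/-- The terms of the Hamiltonian. -/
abbrev Term (L : ℕ) : Type := TermKind × Site L

section
variable {L : ℕ}

/-- The bond in direction 1 that starts at `(p, y)`. -/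
abbrev hb (p y : ZMod L) : Term L := (.hbond, (p, y))
/-- The bond in direction 2 that starts at `(p, y)`. -/
abbrev vb (p y : ZMod L) : Term L := (.vbond, (p, y))
/-- The transverse field at `(p, y)`. -/
abbrev fx (p y : ZMod L) : Term L := (.xfield, (p, y))

/-- The Pauli product of a term. -/
def Term.string : Term L → PauliProduct L
  | (.hbond, r) => fun s => if s = r ∨ s = (r.1 + 1, r.2) then .Z else .I
  | (.vbond, r) => fun s => if s = r ∨ s = (r.1, r.2 + 1) then .Z else .I
  | (.xfield, r) => fun s => if s = r then .X else .I
  | (.zfield, r) => fun s => if s = r then .Z else .I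

/-- Multiplication of a Pauli product by a term, up to a phase. -/
def act (T : Term L) (B : PauliProduct L) : PauliProduct L :=
  fun s => Pauli.mul (T.string s) (B s)

/-- The sign in `[T, T B] = 2 i s B`. -/
def sgn : Term L → PauliProduct L → ℤ
  | (.hbond, r), B => Pauli.sgnZZ (B r) (B (r.1 + 1, r.2))
  | (.vbond, r), B => Pauli.sgnZZ (B r) (B (r.1, r.2 + 1))
  | (.xfield, r), B => Pauli.sgnX (B r)
  | (.zfield, r), B => Pauli.sgnZ (B r)

/-- The coupling constant of a term. -/
def coupling (J₁ J₂ hx hz : ℂ) : TermKind → ℂ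
  | .hbond => J₁ | .vbond => J₂ | .xfield => hx | .zfield => hz

-- Without phases the labels form an abelian group of exponent two.
@[simp] theorem act_act (T : Term L) (B : PauliProduct L) : act T (act T B) = B := by
  funext s; exact Pauli.mul_mul_cancel _ _

theorem act_comm (T T' : Term L) (B : PauliProduct L) : act T (act T' B) = act T' (act T B) := by
  funext s; exact Pauli.mul_left_comm _ _ _

theorem act_hb (p y : ZMod L) (B : PauliProduct L) (s : Site L) :
    act (hb p y) B s = if s = (p, y) ∨ s = (p + 1, y) then Pauli.mul .Z (B s) else B s := by
  simp only [act, Term.string]; split_ifs <;> simp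

theorem act_vb (p y : ZMod L) (B : PauliProduct L) (s : Site L) :
    act (vb p y) B s = if s = (p, y) ∨ s = (p, y + 1) then Pauli.mul .Z (B s) else B s := by
  simp only [act, Term.string]; split_ifs <;> simp

theorem act_fx (p y : ZMod L) (B : PauliProduct L) (s : Site L) :
    act (fx p y) B s = if s = (p, y) then Pauli.mul .X (B s) else B s := by
  simp only [act, Term.string]; split_ifs <;> simp

theorem act_fz (p y : ZMod L) (B : PauliProduct L) (s : Site L) :
    act (.zfield, (p, y)) B s = if s = (p, y) then Pauli.mul .Z (B s) else B s := by
  simp only [act, Term.string]; split_ifs <;> simp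

/-- Column `p` of `A` consists of a single nontrivial operator `P` in row `y`. -/
def ColIs (A : PauliProduct L) (p : ZMod L) (P : Pauli) (y : ZMod L) : Prop :=
  ∀ q, A (p, q) = if q = y then P else .I

theorem ColIs.eq {A : PauliProduct L} {p : ZMod L} {P : Pauli} {y : ZMod L} (h : ColIs A p P y) :
    A (p, y) = P := by rw [h]; simp

theorem ColIs.row_eq {A : PauliProduct L} {p : ZMod L} {P : Pauli} {y z : ZMod L}
    (h : ColIs A p P y) (hz : A (p, z) ≠ .I) : z = y := by
  by_contra hne; exact hz (by rw [h]; simp [hne])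

theorem ColIs.row_unique {A : PauliProduct L} {p : ZMod L} {P Q : Pauli} {y z : ZMod L}
    (h : ColIs A p P y) (h' : ColIs A p Q z) (hQ : Q ≠ .I) : z = y :=
  h.row_eq (by rw [h'.eq]; exact hQ)

/-- Column `p` of `A` is not trivial. -/
def Occupied (A : PauliProduct L) (p : ZMod L) : Prop := ∃ y, A (p, y) ≠ .I

theorem occupied_of_flipsZ {A : PauliProduct L} {p y : ZMod L} (h : (A (p, y)).FlipsZ) :
    Occupied A p := ⟨y, h.ne_I⟩

theorem ColIs.occupied {A : PauliProduct L} {p : ZMod L} {P : Pauli} {y : ZMod L}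
    (h : ColIs A p P y) (hP : P ≠ .I) : Occupied A p := ⟨y, by rwa [h.eq]⟩

/-- A term that empties a column is a bond in direction 1 that removes a single `Z`. -/
theorem exists_of_not_occupied_act [Fact (1 < L)] {T : Term L} {B : PauliProduct L} {p : ZMod L}
    (hs : sgn T B ≠ 0) (hB : Occupied B p) (hT : ¬ Occupied (act T B) p) :
    ∃ y, ColIs B p .Z y ∧ ((T = hb p y ∧ (B (p + 1, y)).FlipsZ) ∨
      (T = hb (p - 1) y ∧ (B (p - 1, y)).FlipsZ)) := by
  obtain ⟨y, hy⟩ := hB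
  simp only [Occupied, not_exists, not_not] at hT
  obtain ⟨kd, ⟨p', y'⟩⟩ := T
  have hp1 : ∀ p : ZMod L, p + 1 ≠ p := by intro p; simp
  cases kd
  · -- bond in direction 1
    simp only [act_hb, Prod.mk.injEq] at hT
    by_cases h1 : p = p'
    · subst h1
      have hz : B (p, y') = .Z := by
        have := hT y'; simp at this; generalize B (p, y') = b at this; cases b <;> simp_all [Pauli.mul]
      refine ⟨y', fun q => ?_, Or.inl ⟨rfl, ?_⟩⟩
      · have := hT q
        by_cases hq : q = y'
        · subst hq; simp [hz]
        · simpa [hq] using this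
      · simp only [sgn, hz] at hs
        generalize B (p + 1, y') = b at hs
        cases b <;> simp_all [Pauli.sgnZZ, Pauli.sgnZ]
    · by_cases h2 : p = p' + 1
      · subst h2
        have hz : B (p' + 1, y') = .Z := by
          have := hT y'; simp at this
          generalize B (p' + 1, y') = b at this; cases b <;> simp_all [Pauli.mul]
        refine ⟨y', fun q => ?_, Or.inr ⟨by simp, ?_⟩⟩
        · have := hT q
          by_cases hq : q = y'
          · subst hq; simp [hz]
          · simpa [hq] using this
        · simp only [sgn, hz] at hs
          simp only [add_sub_cancel_right]
          generalize B (p', y') = b at hs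
          cases b <;> simp_all [Pauli.sgnZZ, Pauli.sgnZ]
      · exact absurd (by simpa [h1, h2] using hT y) hy
  -- A bond inside the column empties it only if both its ends carry `Z`, and a field only if it
  -- meets its own operator. In these cases the term commutes with `B`.
  · simp only [act_vb, Prod.mk.injEq] at hT
    by_cases h1 : p = p'
    · subst h1
      have h3 := hT y'
      have h4 := hT (y' + 1)
      simp only [sgn] at hs
      simp at h3 h4
      generalize B (p, y') = b at *
      generalize B (p, y' + 1) = b' at *
      cases b <;> cases b' <;> simp_all [Pauli.sgnZZ, Pauli.sgnZ, Pauli.mul]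
    · exact absurd (by simpa [h1] using hT y) hy
  · simp only [act_fx, Prod.mk.injEq] at hT
    by_cases h1 : p = p'
    · subst h1
      have h3 := hT y'
      simp only [sgn] at hs
      simp at h3
      generalize B (p, y') = b at *
      cases b <;> simp_all [Pauli.sgnX, Pauli.mul]
    · exact absurd (by simpa [h1] using hT y) hy
  · simp only [act_fz, Prod.mk.injEq] at hT
    by_cases h1 : p = p'
    · subst h1
      have h3 := hT y'
      simp only [sgn] at hs
      simp at h3
      generalize B (p, y') = b at *
      cases b <;> simp_all [Pauli.sgnZ, Pauli.mul]
    · exact absurd (by simpa [h1] using hT y) hy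

/-- Only the transverse field turns `X` or `Y` into `I` or `Z`. -/
theorem eq_fx_of_not_flipsZ_act {T : Term L} {B : PauliProduct L} {p y : ZMod L}
    (hs : sgn T B ≠ 0) (hB : (B (p, y)).FlipsZ) (hT : ¬ (act T B (p, y)).FlipsZ) :
    T = fx p y ∧ B (p, y) = .Y := by
  obtain ⟨kd, ⟨p', y'⟩⟩ := T
  cases kd
  · rw [act_hb] at hT; split_ifs at hT with h
    · exact absurd hB.mul_Z hT
    · exact absurd hB hT
  · rw [act_vb] at hT; split_ifs at hT with h
    · exact absurd hB.mul_Z hT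
    · exact absurd hB hT
  · rw [act_fx] at hT; split_ifs at hT with h
    · refine ⟨by rw [← h], ?_⟩
      rw [h] at hB hT ⊢
      simp only [sgn] at hs
      generalize B (p', y') = b at *
      cases b <;> simp_all [Pauli.sgnX, Pauli.mul]
    · exact absurd hB hT
  · rw [act_fz] at hT; split_ifs at hT with h
    · exact absurd hB.mul_Z hT
    · exact absurd hB hT

/-- A term that changes two neighbours in direction 2 is their bond. -/
theorem eq_vb_of_act_ne (hL : 3 ≤ L) {T : Term L} {B : PauliProduct L} {p y : ZMod L}
    (h₀ : act T B (p, y) ≠ B (p, y)) (h₁ : act T B (p, y + 1) ≠ B (p, y + 1)) :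
    T = vb p y := by
  have : Fact (1 < L) := ⟨by omega⟩
  -- With only two rows, the bonds that start at `y` and at `y + 1` would join the same two sites.
  have h2 : ∀ y : ZMod L, y + 1 + 1 ≠ y := by
    intro y h
    have : ((2 : ℕ) : ZMod L) = 0 := by
      have : y + 1 + 1 - y = 0 := by rw [h]; ring
      push_cast; linear_combination this
    rw [ZMod.natCast_eq_zero_iff] at this
    exact absurd (Nat.le_of_dvd (by norm_num) this) (by omega)
  obtain ⟨kd, ⟨p', y'⟩⟩ := T
  cases kd
  · simp only [act_hb, Prod.mk.injEq, ne_eq, ite_eq_right_iff, not_forall] at h₀ h₁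
    obtain ⟨h₀, -⟩ := h₀
    obtain ⟨h₁, -⟩ := h₁
    exfalso
    have hy : y = y' := by tauto
    have hy' : y + 1 = y' := by tauto
    simp [hy] at hy'
  · simp only [act_vb, Prod.mk.injEq, ne_eq, ite_eq_right_iff, not_forall] at h₀ h₁
    obtain ⟨h₀, -⟩ := h₀
    obtain ⟨h₁, -⟩ := h₁
    have hp : p = p' := by tauto
    subst hp
    rcases h₀ with h | h
    · rw [h.2]
    · exfalso
      rcases h₁ with h' | h'
      · exact h2 y' (by rw [← h.2]; exact h'.2)
      · rw [h.2] at h'; simp at h'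
  · simp only [act_fx, Prod.mk.injEq, ne_eq, ite_eq_right_iff, not_forall] at h₀ h₁
    obtain ⟨h₀, -⟩ := h₀
    obtain ⟨h₁, -⟩ := h₁
    exfalso
    rw [← h₀.2] at h₁; simp at h₁
  · simp only [act_fz, Prod.mk.injEq, ne_eq, ite_eq_right_iff, not_forall] at h₀ h₁
    obtain ⟨h₀, -⟩ := h₀
    obtain ⟨h₁, -⟩ := h₁
    exfalso
    rw [← h₀.2] at h₁; simp at h₁

end

/-! ### Columns on the periodic lattice, chains, and the linear system -/

section
variable {L : ℕ}

/-- The column `i` steps after column `x`. -/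
def sh (x : ZMod L) (i : ℕ) : ZMod L := x + i

@[simp] theorem sh_zero (x : ZMod L) : sh x 0 = x := by simp [sh]

theorem sh_sh (x : ZMod L) (i j : ℕ) : sh (sh x i) j = sh x (i + j) := by
  simp only [sh]; push_cast; ring

@[simp] theorem sh_one_sh (x : ZMod L) (i : ℕ) : sh (sh x 1) i = sh x (i + 1) := by
  rw [sh_sh, add_comm]

theorem sh_add_one (x : ZMod L) (i : ℕ) : sh x i + 1 = sh x (i + 1) := by
  simp only [sh]; push_cast; ring

theorem add_one_eq_sh (x : ZMod L) : x + 1 = sh x 1 := by simp [sh]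

theorem sh_succ_sub_one (x : ZMod L) (i : ℕ) : sh x (i + 1) - 1 = sh x i := by
  simp only [sh]; push_cast; ring

theorem exists_eq_sh_one (x : ZMod L) : ∃ z, x = sh z 1 := ⟨x - 1, by simp [sh]⟩

theorem natCast_inj_of_lt {i j : ℕ} (hi : i < L) (hj : j < L) (h : (i : ZMod L) = j) : i = j := by
  rw [ZMod.natCast_eq_natCast_iff'] at h
  rwa [Nat.mod_eq_of_lt hi, Nat.mod_eq_of_lt hj] at h

theorem sh_inj {x : ZMod L} {i j : ℕ} (hi : i < L) (hj : j < L) : sh x i = sh x j ↔ i = j :=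
  ⟨fun h => natCast_inj_of_lt hi hj (by simpa [sh] using h), fun h => by rw [h]⟩

theorem sh_ne {x : ZMod L} {i j : ℕ} (hi : i < L) (hj : j < L) (h : i ≠ j) : sh x i ≠ sh x j :=
  fun h' => h ((sh_inj hi hj).1 h')

theorem sh_ne_self {x : ZMod L} {i : ℕ} (hi : i < L) (h : 0 < i) : sh x i ≠ x := by
  have := sh_ne (x := x) hi (show 0 < L by omega) (show i ≠ 0 by omega)
  simpa using this

theorem exists_eq_sh [NeZero L] (x p : ZMod L) : ∃ i < L, p = sh x i :=
  ⟨(p - x).val, ZMod.val_lt _, by simp [sh]⟩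

theorem sub_one_eq_sh [NeZero L] (x : ZMod L) : x - 1 = sh x (L - 1) := by
  have : 1 ≤ L := NeZero.one_le
  simp only [sh]; push_cast [this]; simp; ring

/-- The support of `A` lies in the `n` columns that start at `x`. -/
def InWindow (A : PauliProduct L) (x : ZMod L) (n : ℕ) : Prop :=
  ∀ p y, A (p, y) ≠ .I → ∃ i < n, p = sh x i

theorem InWindow.eq_I {A : PauliProduct L} {x : ZMod L} {n i : ℕ} (h : InWindow A x n)
    (hn : n ≤ i) (hi : i < L) (y : ZMod L) : A (sh x i, y) = .I := by
  by_contra hne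
  obtain ⟨j, hj, hij⟩ := h _ _ hne
  rw [sh_inj hi (by omega)] at hij
  omega

theorem InWindow.left_eq_I [NeZero L] {A : PauliProduct L} {x : ZMod L} {n : ℕ}
    (h : InWindow A x n) (hn : n < L) (y : ZMod L) : A (x - 1, y) = .I := by
  rw [sub_one_eq_sh]; exact h.eq_I (by omega) (by omega) y

/-- The entries of a chain of `n` operators: `a`, then `X`s, then `b`. -/
def chainEntry (n : ℕ) (a b : Pauli) (i : ℕ) : Pauli :=
  if i = 0 then a else if i + 1 = n then b else if i + 1 < n then .X else .I

/-- The Pauli product `a X ⋯ X b` on `n` consecutive sites of row `y` that start at column `x`. -/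
def chain (x : ZMod L) (n : ℕ) (a b : Pauli) (y : ZMod L) : PauliProduct L :=
  fun s => if s.2 = y then chainEntry n a b (s.1 - x).val else .I

theorem chain_sh {x : ZMod L} {n : ℕ} {a b : Pauli} {y q : ZMod L} {i : ℕ} (hi : i < L) :
    chain x n a b y (sh x i, q) = if q = y then chainEntry n a b i else .I := by
  simp [chain, sh, ZMod.val_natCast_of_lt hi]

theorem chain_self [NeZero L] {x : ZMod L} {n : ℕ} {a b : Pauli} {y q : ZMod L} :
    chain x n a b y (x, q) = if q = y then a else .I := by
  simp [chain, chainEntry]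

theorem inWindow_chain [NeZero L] (x : ZMod L) {n : ℕ} (hn : 1 ≤ n) (a b : Pauli) (y : ZMod L) :
    InWindow (chain x n a b y) x n := by
  intro p q h
  obtain ⟨i, hi, rfl⟩ := exists_eq_sh x p
  refine ⟨i, ?_, rfl⟩
  rw [chain_sh hi] at h
  by_contra hlt
  simp [chainEntry, show i ≠ 0 by omega, show i + 1 ≠ n by omega, show ¬ i + 1 < n by omega] at h

/-- A family of Pauli products on `m + 2` columns that is stable under a shift that inserts an `X`
at the left end consists of chains. -/
theorem eq_chain_of_shift [NeZero L] {m : ℕ} (hm : 1 ≤ m) {b : Pauli}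
    (P : ZMod L → PauliProduct L → Prop)
    (window : ∀ x A, P x A → InWindow A x (m + 2))
    (left : ∀ x A, P x A → ∃ y, ColIs A x .Z y)
    (right : ∀ x A, P x A → ∃ y, ColIs A (sh x (m + 1)) b y)
    (shift : ∀ z A y y₀, P (sh z 1) A → ColIs A (sh z 1) .Z y → ColIs A (sh z (m + 2)) b y₀ →
      ColIs A (sh z (m + 1)) .X y₀ ∧ ∃ A', P z A' ∧ ColIs A' (sh z 1) .X y ∧
        ColIs A' (sh z (m + 1)) b y₀ ∧ ∀ i, 2 ≤ i → i ≤ m → ∀ q, A' (sh z i, q) = A (sh z i, q))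
    (x : ZMod L) (A : PauliProduct L) (hA : P x A) : ∃ y, A = chain x (m + 2) .Z b y := by
  -- Each shift brings a given column one step closer to the right end without changing it. A column
  -- next to the right end is an `X` in the row of `b`.
  have key : ∀ i < m, ∀ x A y₀, P x A → ColIs A (sh x (m + 1)) b y₀ →
      ColIs A (sh x (m - i)) .X y₀ := by
    intro i
    induction i with
    | zero =>
      intro hi x A y₀ hP hy₀
      obtain ⟨z, rfl⟩ := exists_eq_sh_one x
      obtain ⟨y, hy⟩ := left _ _ hP
      rw [sh_one_sh] at hy₀ ⊢
      exact (shift z A y y₀ hP hy hy₀).1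
    | succ i ih =>
      intro hi x A y₀ hP hy₀
      obtain ⟨z, rfl⟩ := exists_eq_sh_one x
      obtain ⟨y, hy⟩ := left _ _ hP
      rw [sh_one_sh] at hy₀ ⊢
      obtain ⟨-, A', hP', -, hr, hmid⟩ := shift z A y y₀ hP hy hy₀
      have := ih (by omega) z A' y₀ hP' hr
      rw [show m - (i + 1) + 1 = m - i by omega]
      intro q
      rw [← hmid (m - i) (by omega) (by omega), this q]
  obtain ⟨y, hy⟩ := left _ _ hA
  obtain ⟨y₀, hy₀⟩ := right _ _ hA
  -- After one shift the left `Z` has become an interior `X` in the same row, so `key` determines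
  -- its row.
  have hyy : y = y₀ := by
    obtain ⟨z, rfl⟩ := exists_eq_sh_one x
    rw [sh_one_sh] at hy₀
    obtain ⟨-, A', hP', hl, hr, -⟩ := shift z A y y₀ hA hy hy₀
    have := key (m - 1) (by omega) z A' y₀ hP' hr
    rw [show m - (m - 1) = 1 by omega] at this
    exact this.row_unique hl (by simp)
  subst hyy
  refine ⟨y, ?_⟩
  funext ⟨p, q⟩
  obtain ⟨i, hi, rfl⟩ := exists_eq_sh x p
  rw [chain_sh hi]
  rcases Nat.eq_zero_or_pos i with rfl | hi0
  · rw [sh_zero, hy]; simp [chainEntry]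
  by_cases h1 : i = m + 1
  · subst h1; rw [hy₀]; simp [chainEntry]
  by_cases h2 : i < m + 1
  · have := key (m - i) (by omega) x A y hA hy₀
    rw [show m - (m - i) = i by omega] at this
    rw [this]
    simp [chainEntry, show i ≠ 0 by omega, h1, h2]
  · rw [(window _ _ hA).eq_I (by omega) hi]
    simp [chainEntry, show i ≠ 0 by omega, h1, h2]

/-- The coefficients `c` solve the equations for a conserved quantity of width at most `m + 2`. -/
structure IsSolution [NeZero L] (m : ℕ) (J₁ J₂ hx hz : ℂ) (c : PauliProduct L → ℂ) : Prop where
  one_le : 1 ≤ m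
  le_size : 2 * (m + 2) ≤ L
  J₁_ne : J₁ ≠ 0
  J₂_ne : J₂ ≠ 0
  hx_ne : hx ≠ 0
  sum_eq : ∀ B, ∑ T : Term L, coupling J₁ J₂ hx hz T.1 * sgn T B * c (act T B) = 0
  window : ∀ A, c A ≠ 0 → ∃ x, InWindow A x (m + 2)

variable [NeZero L] {m : ℕ} {J₁ J₂ hx hz : ℂ} {c : PauliProduct L → ℂ}

namespace IsSolution

/-- A nonzero summand in the equation of `B` must be cancelled by another one. The longitudinal
field is excluded because its coupling may be zero. -/
theorem exists_ne_term (S : IsSolution m J₁ J₂ hx hz c) {T : Term L} {B : PauliProduct L}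
    (hT : T.1 ≠ .zfield) (hs : sgn T B ≠ 0) (hc : c (act T B) ≠ 0) :
    ∃ T', T' ≠ T ∧ sgn T' B ≠ 0 ∧ c (act T' B) ≠ 0 := by
  by_contra! h
  have h0 := S.sum_eq B
  rw [Finset.sum_eq_single T] at h0
  · have hJ : coupling J₁ J₂ hx hz T.1 ≠ 0 := by
      obtain ⟨kd, r⟩ := T
      cases kd
      exacts [S.J₁_ne, S.J₂_ne, S.hx_ne, absurd rfl hT]
    exact mul_ne_zero (mul_ne_zero hJ (by exact_mod_cast hs)) hc h0
  · intro T' _ hne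
    by_cases hs' : sgn T' B = 0
    · simp [hs']
    · rw [h T' hne hs', mul_zero]
  · simp

theorem sum_finset_eq (S : IsSolution m J₁ J₂ hx hz c) (B : PauliProduct L) (s : Finset (Term L))
    (h : ∀ T, sgn T B ≠ 0 → c (act T B) ≠ 0 → T ∈ s) :
    ∑ T ∈ s, coupling J₁ J₂ hx hz T.1 * sgn T B * c (act T B) = 0 := by
  rw [← S.sum_eq B]
  refine Finset.sum_subset (Finset.subset_univ _) fun T _ hT => ?_
  by_contra hne
  exact hT (h T (fun h0 => hne (by simp [h0])) fun h0 => hne (by simp [h0]))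

/-- Two offsets below `m + 2` cannot differ by `m + 2` modulo `L`, since `2 * (m + 2) ≤ L`. -/
theorem not_occupied (S : IsSolution m J₁ J₂ hx hz c) {A : PauliProduct L} (hA : c A ≠ 0)
    {x : ZMod L} (h₀ : Occupied A x) : ¬ Occupied A (sh x (m + 2)) := by
  rintro ⟨y', hy'⟩
  obtain ⟨y, hy⟩ := h₀
  have := S.le_size
  obtain ⟨s, hs⟩ := S.window A hA
  obtain ⟨i, hi, rfl⟩ := hs _ _ hy
  obtain ⟨j, hj, hij⟩ := hs _ _ hy'
  rw [sh_sh, sh_inj (by omega) (by omega)] at hij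
  omega

theorem inWindow (S : IsSolution m J₁ J₂ hx hz c) {A : PauliProduct L} (hA : c A ≠ 0)
    {x : ZMod L} (h₀ : Occupied A x) (h₁ : Occupied A (sh x (m + 1))) : InWindow A x (m + 2) := by
  obtain ⟨y', hy'⟩ := h₁
  obtain ⟨y, hy⟩ := h₀
  have := S.le_size
  obtain ⟨s, hs⟩ := S.window A hA
  obtain ⟨i, hi, rfl⟩ := hs _ _ hy
  obtain ⟨j, hj, hij⟩ := hs _ _ hy'
  rw [sh_sh, sh_inj (by omega) (by omega)] at hij
  obtain rfl : i = 0 := by omega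
  simpa using hs

end IsSolution

end

/-! ### Products of maximal width with an `X` or `Y` in the last column -/

section
variable {L : ℕ}

theorem sgn_hb_ne_zero {p y : ZMod L} {B : PauliProduct L}
    (h : ((B (p, y)).FlipsZ ∧ ¬ (B (p + 1, y)).FlipsZ) ∨
      (¬ (B (p, y)).FlipsZ ∧ (B (p + 1, y)).FlipsZ)) : sgn (hb p y) B ≠ 0 := by
  simp only [sgn]
  generalize B (p, y) = b at *
  generalize B (p + 1, y) = b' at *
  cases b <;> cases b' <;> simp_all [Pauli.sgnZZ, Pauli.sgnZ]

theorem occupied_act_of_flipsZ [Fact (1 < L)] {T : Term L} {B : PauliProduct L} {p y : ZMod L}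
    (hs : sgn T B ≠ 0) (hB : (B (p, y)).FlipsZ) : Occupied (act T B) p := by
  by_contra h
  obtain ⟨y', hy', -⟩ := exists_of_not_occupied_act hs (occupied_of_flipsZ hB) h
  rw [hy'] at hB
  split_ifs at hB <;> simp at hB

variable [NeZero L] [Fact (1 < L)] {m : ℕ} {J₁ J₂ hx hz : ℂ} {c : PauliProduct L → ℂ}

namespace IsSolution

/-- Attaching a bond on the right yields a product `B` on `m + 3` columns. A second term in its
equation has to empty an end column. Only the attached bond can empty the new last one, so the
second term is a bond removing a single `Z` from the first. -/
theorem exists_left_of_flipsZ_right (S : IsSolution m J₁ J₂ hx hz c) {A : PauliProduct L}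
    (hA : c A ≠ 0) {x y : ZMod L} (hl : Occupied A x) (hr : (A (sh x (m + 1), y)).FlipsZ) :
    ∃ y', ColIs A x .Z y' ∧ (A (sh x 1, y')).FlipsZ ∧
      c (act (hb x y') (act (hb (sh x (m + 1)) y) A)) ≠ 0 := by
  have hm := S.one_le
  have hL := S.le_size
  have hw := S.inWindow hA hl (occupied_of_flipsZ hr)
  have n1 : x ≠ sh x (m + 1) := (sh_ne_self (by omega) (by omega)).symm
  have n2 : x ≠ sh x (m + 2) := (sh_ne_self (by omega) (by omega)).symm
  have n3 : sh x (m + 2) ≠ sh x (m + 1) := sh_ne (by omega) (by omega) (by omega)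
  have n4 : sh x 1 ≠ sh x (m + 2) := sh_ne (by omega) (by omega) (by omega)
  have n5 : x - 1 ≠ sh x (m + 1) := by rw [sub_one_eq_sh]; exact sh_ne (by omega) (by omega) (by omega)
  have n6 : x - 1 ≠ sh x (m + 2) := by rw [sub_one_eq_sh]; exact sh_ne (by omega) (by omega) (by omega)
  have hout := hw.eq_I (i := m + 2) le_rfl (by omega)
  set T := hb (sh x (m + 1)) y with hT
  set B := act T A with hB
  have eB : ∀ s, B s = if s = (sh x (m + 1), y) ∨ s = (sh x (m + 2), y) then
      Pauli.mul .Z (A s) else A s := by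
    intro s; rw [hB, hT, act_hb, sh_add_one]
  have hBx : ∀ q, B (x, q) = A (x, q) := by intro q; simp [eB, n1, n2]
  have hBr : B (sh x (m + 2), y) = .Z := by simp [eB, hout, Pauli.mul]
  have hBcol : ColIs B (sh x (m + 2)) .Z y := by
    intro q; by_cases hq : q = y
    · subst hq; simp [hBr]
    · simp [eB, n3, hq, hout]
  have hs : sgn T B ≠ 0 := by
    apply sgn_hb_ne_zero
    left
    rw [sh_add_one, hBr]
    refine ⟨?_, by simp⟩
    simp only [eB, true_or, if_true]; exact hr.mul_Z
  obtain ⟨T', hne, hs', hc'⟩ := S.exists_ne_term (T := T) (B := B) (by simp [hT]) hs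
    (by rw [hB, act_act]; exact hA)
  have hlB : Occupied B x := by obtain ⟨q, hq⟩ := hl; exact ⟨q, by rwa [hBx]⟩
  by_cases hk : Occupied (act T' B) x
  · exfalso
    obtain ⟨q, hq, h | h⟩ := exists_of_not_occupied_act hs' (hBcol.occupied (by simp))
      (S.not_occupied hc' hk)
    · have h3 := h.2
      rw [sh_add_one, eB] at h3
      have h4 : sh x (m + 3) ≠ sh x (m + 1) := sh_ne (by omega) (by omega) (by omega)
      have h5 : sh x (m + 3) ≠ sh x (m + 2) := sh_ne (by omega) (by omega) (by omega)
      simp [h4, h5, hw.eq_I (i := m + 3) (by omega) (by omega)] at h3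
    · apply hne
      rw [h.1, hBcol.row_unique hq (by simp), sh_succ_sub_one]
  · obtain ⟨q, hq, h | h⟩ := exists_of_not_occupied_act hs' hlB hk
    · refine ⟨q, fun r => by rw [← hBx, hq], ?_, by rw [← h.1]; exact hc'⟩
      have h3 := h.2
      rw [add_one_eq_sh, eB] at h3
      split_ifs at h3 with h4
      · rcases h4 with h4 | h4
        · rw [h4] at h3 ⊢; exact hr
        · exact absurd (Prod.mk.inj h4).1 n4
      · exact h3
    · exfalso
      have h3 := h.2
      simp [eB, n5, n6, hw.left_eq_I (by omega)] at h3

/-- Mirror image of `exists_left_of_flipsZ_right`, with the bond attached on the left. -/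
theorem exists_right_of_flipsZ_left (S : IsSolution m J₁ J₂ hx hz c) {A : PauliProduct L}
    (hA : c A ≠ 0) {z y : ZMod L} (hl : (A (sh z 1, y)).FlipsZ) (hr : Occupied A (sh z (m + 2))) :
    ∃ y', ColIs A (sh z (m + 2)) .Z y' ∧ (A (sh z (m + 1), y')).FlipsZ ∧
      c (act (hb (sh z (m + 1)) y') (act (hb z y) A)) ≠ 0 := by
  have hm := S.one_le
  have hL := S.le_size
  have hw := S.inWindow hA (occupied_of_flipsZ hl) (by simpa using hr)
  have n1 : z ≠ sh z 1 := (sh_ne_self (by omega) (by omega)).symm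
  have n2 : sh z (m + 2) ≠ z := sh_ne_self (by omega) (by omega)
  have n3 : sh z (m + 2) ≠ sh z 1 := sh_ne (by omega) (by omega) (by omega)
  have n4 : sh z (m + 3) ≠ z := sh_ne_self (by omega) (by omega)
  have n5 : sh z (m + 3) ≠ sh z 1 := sh_ne (by omega) (by omega) (by omega)
  have n6 : sh z (m + 1) ≠ z := sh_ne_self (by omega) (by omega)
  have n7 : z - 1 ≠ z := by simp
  have n8 : z - 1 ≠ sh z 1 := by rw [sub_one_eq_sh]; exact sh_ne (by omega) (by omega) (by omega)
  have hout : ∀ q, A (z, q) = .I := by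
    intro q
    have := hw.left_eq_I (by omega) q
    rwa [show sh z 1 - 1 = z by simp [sh]] at this
  have hout' : ∀ q, A (z - 1, q) = .I := by
    intro q
    have := hw.eq_I (i := L - 2) (by omega) (by omega) q
    rwa [sh_one_sh, show L - 2 + 1 = L - 1 by omega, ← sub_one_eq_sh] at this
  have hout3 : ∀ q, A (sh z (m + 3), q) = .I := by
    intro q
    have := hw.eq_I (i := m + 2) (by omega) (by omega) q
    rwa [sh_one_sh] at this
  set T := hb z y with hT
  set B := act T A with hB
  have eB : ∀ s, B s = if s = (z, y) ∨ s = (sh z 1, y) then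
      Pauli.mul .Z (A s) else A s := by
    intro s; rw [hB, hT, act_hb, add_one_eq_sh]
  have hBr : ∀ q, B (sh z (m + 2), q) = A (sh z (m + 2), q) := by intro q; simp [eB, n2, n3]
  have hBl : B (z, y) = .Z := by simp [eB, hout, Pauli.mul]
  have hBcol : ColIs B z .Z y := by
    intro q; by_cases hq : q = y
    · subst hq; simp [hBl]
    · simp [eB, n1, hq, hout]
  have hs : sgn T B ≠ 0 := by
    apply sgn_hb_ne_zero
    right
    rw [add_one_eq_sh, hBl]
    refine ⟨by simp, ?_⟩
    simp only [eB, or_true, if_true]; exact hl.mul_Z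
  obtain ⟨T', hne, hs', hc'⟩ := S.exists_ne_term (T := T) (B := B) (by simp [hT]) hs
    (by rw [hB, act_act]; exact hA)
  have hlB : Occupied B (sh z (m + 2)) := by obtain ⟨q, hq⟩ := hr; exact ⟨q, by rwa [hBr]⟩
  by_cases hk : Occupied (act T' B) (sh z (m + 2))
  · exfalso
    obtain ⟨q, hq, h | h⟩ := exists_of_not_occupied_act hs' (hBcol.occupied (by simp))
      (fun h => S.not_occupied hc' h hk)
    · apply hne
      rw [h.1, hBcol.row_unique hq (by simp)]
    · have h3 := h.2
      simp [eB, n8, hout'] at h3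
  · obtain ⟨q, hq, h | h⟩ := exists_of_not_occupied_act hs' hlB hk
    · exfalso
      have h3 := h.2
      rw [sh_add_one] at h3
      simp [eB, n4, n5, hout3] at h3
    · have h1 := h.1
      have h3 := h.2
      rw [sh_succ_sub_one] at h1 h3
      refine ⟨q, fun r => by rw [← hBr, hq], ?_, by rw [← h1]; exact hc'⟩
      rw [eB] at h3
      split_ifs at h3 with h4
      · rcases h4 with h4 | h4
        · exact absurd (Prod.mk.inj h4).1 n6
        · rw [h4] at h3 ⊢; exact hl
      · exact h3

/-- Turn the left `Z` into `Y` by the transverse field. Any other term in this equation keeps an `X`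
or `Y` there, so `exists_right_of_flipsZ_left` makes the last column of its result a single `Z`.
Hence that term is a field acting on a `Y` in the last column, and the same lemma supplies the
shifted product `A'`. -/
theorem exists_shift_of_flipsZ_right (S : IsSolution m J₁ J₂ hx hz c) {A : PauliProduct L}
    (hA : c A ≠ 0) {z y y₁ : ZMod L} (hl : ColIs A (sh z 1) .Z y)
    (hr : (A (sh z (m + 2), y₁)).FlipsZ) :
    ColIs A (sh z (m + 2)) .Y y₁ ∧ ∃ A', c A' ≠ 0 ∧ Occupied A' z ∧ ColIs A' (sh z 1) .X y ∧
      (A' (sh z (m + 1), y₁)).FlipsZ ∧ (∀ i, 2 ≤ i → i ≤ m → ∀ q, A' (sh z i, q) = A (sh z i, q)) ∧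
      ∀ q, A (sh z (m + 1), q) = if q = y₁ then Pauli.mul .Z (A' (sh z (m + 1), q)) else
        A' (sh z (m + 1), q) := by
  have hm := S.one_le
  have hL := S.le_size
  have n1 : z ≠ sh z 1 := (sh_ne_self (by omega) (by omega)).symm
  have n2 : sh z (m + 2) ≠ z := sh_ne_self (by omega) (by omega)
  have n3 : sh z (m + 2) ≠ sh z 1 := sh_ne (by omega) (by omega) (by omega)
  have n4 : sh z (m + 1) ≠ z := sh_ne_self (by omega) (by omega)
  have n5 : sh z (m + 1) ≠ sh z 1 := sh_ne (by omega) (by omega) (by omega)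
  have n6 : sh z (m + 1) ≠ sh z (m + 2) := sh_ne (by omega) (by omega) (by omega)
  have hw := S.inWindow hA (hl.occupied (by simp)) (by simpa using occupied_of_flipsZ hr)
  have hout : ∀ q, A (z, q) = .I := by
    intro q
    have := hw.left_eq_I (by omega) q
    rwa [show sh z 1 - 1 = z by simp [sh]] at this
  set T := fx (sh z 1) y with hT
  set B := act T A with hB
  have eB : ∀ s, B s = if s = (sh z 1, y) then Pauli.mul .X (A s) else A s := by
    intro s; rw [hB, hT, act_fx]
  have hBl : B (sh z 1, y) = .Y := by simp [eB, hl.eq, Pauli.mul]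
  have hBr : ∀ q, B (sh z (m + 2), q) = A (sh z (m + 2), q) := by intro q; simp [eB, n3]
  have hs : sgn T B ≠ 0 := by simp [hT, sgn, hBl, Pauli.sgnX]
  obtain ⟨T', hne, hs', hc'⟩ := S.exists_ne_term (T := T) (B := B) (by simp [hT]) hs
    (by rw [hB, act_act]; exact hA)
  have hfl : (act T' B (sh z 1, y)).FlipsZ := by
    by_contra h
    exact hne (eq_fx_of_not_flipsZ_act hs' (by simp [hBl]) h).1
  obtain ⟨y₀, hy₀, hf, hc2⟩ := S.exists_right_of_flipsZ_left hc' hfl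
    (occupied_act_of_flipsZ hs' (y := y₁) (by rwa [hBr]))
  obtain ⟨hT', hY⟩ := eq_fx_of_not_flipsZ_act hs' (p := sh z (m + 2)) (y := y₁) (by rwa [hBr])
    (by rw [hy₀]; split_ifs <;> simp)
  have e1 : ∀ s, act T' B s = if s = (sh z (m + 2), y₁) then Pauli.mul .X (B s) else B s := by
    intro s; rw [hT', act_fx]
  have h01 : y₁ = y₀ := hy₀.row_eq (by rw [e1, if_pos rfl, hY]; simp [Pauli.mul])
  subst h01
  refine ⟨fun q => ?_, _, hc2, ⟨y, ?_⟩, fun q => ?_, ?_, fun i h2 him q => ?_, fun q => ?_⟩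
  · by_cases hq : q = y₁
    · subst hq; rw [← hBr, hY]; simp
    · have := hy₀ q
      rw [e1] at this
      simpa [hq, hBr] using this
  · simp [act_hb, e1, eB, n4.symm, n2.symm, n1, hout, Pauli.mul, sh_add_one]
  · simp only [act_hb, e1, eB, sh_add_one, add_one_eq_sh z, Prod.mk.injEq, n5.symm, n3.symm, n1.symm,
      false_and, or_false, if_false, false_or, true_and, hl q]
    split_ifs <;> simp_all [Pauli.mul]
  · rw [act_hb, if_pos (by simp)]
    apply Pauli.FlipsZ.mul_Z
    rw [act_hb]
    split_ifs
    · exact hf.mul_Z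
    · exact hf
  · have i1 : sh z i ≠ sh z 1 := sh_ne (by omega) (by omega) (by omega)
    have i2 : sh z i ≠ sh z (m + 1) := sh_ne (by omega) (by omega) (by omega)
    have i3 : sh z i ≠ sh z (m + 2) := sh_ne (by omega) (by omega) (by omega)
    have i4 : sh z i ≠ z := sh_ne_self (by omega) (by omega)
    simp [act_hb, e1, eB, sh_add_one, add_one_eq_sh z, i1, i2, i3, i4]
  · by_cases hq : q = y₁
    · simp [act_hb, e1, eB, sh_add_one, add_one_eq_sh z, n4, n5, n6, hq, Pauli.mul_mul_cancel]
    · simp [act_hb, e1, eB, sh_add_one, add_one_eq_sh z, n4, n5, n6, hq]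

/-- Products of maximal width with an `X` or `Y` in the last column are chains. -/
theorem eq_chain_of_flipsZ_right (S : IsSolution m J₁ J₂ hx hz c) {A : PauliProduct L}
    (hA : c A ≠ 0) {x y : ZMod L} (hl : Occupied A x) (hr : (A (sh x (m + 1), y)).FlipsZ) :
    ∃ y, A = chain x (m + 2) .Z .Y y := by
  have left : ∀ x A, (c A ≠ 0 ∧ Occupied A x ∧ ∃ y, (A (sh x (m + 1), y)).FlipsZ) →
      ∃ y, ColIs A x .Z y := by
    rintro x A ⟨hc, hl, y, hr⟩
    obtain ⟨y', h, -⟩ := S.exists_left_of_flipsZ_right hc hl hr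
    exact ⟨y', h⟩
  have right : ∀ x A, (c A ≠ 0 ∧ Occupied A x ∧ ∃ y, (A (sh x (m + 1), y)).FlipsZ) →
      ∃ y, ColIs A (sh x (m + 1)) .Y y := by
    rintro x A ⟨hc, hl, y, hr⟩
    obtain ⟨y', h⟩ := left x A ⟨hc, hl, y, hr⟩
    obtain ⟨z, rfl⟩ := exists_eq_sh_one x
    rw [sh_one_sh] at hr ⊢
    exact ⟨y, (S.exists_shift_of_flipsZ_right hc h hr).1⟩
  refine eq_chain_of_shift S.one_le
    (fun x A => c A ≠ 0 ∧ Occupied A x ∧ ∃ y, (A (sh x (m + 1), y)).FlipsZ) ?_ left right ?_ x A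
    ⟨hA, hl, y, hr⟩
  · rintro x A ⟨hc, hl, y, hr⟩
    exact S.inWindow hc hl (occupied_of_flipsZ hr)
  · rintro z A y y₀ ⟨hc, hl, y₁, hr⟩ h h₀
    rw [sh_one_sh] at hr
    obtain ⟨h1, A', hc', hz', hx', hf, hmid, hlast⟩ := S.exists_shift_of_flipsZ_right hc h hr
    obtain rfl : y₀ = y₁ := h1.row_unique h₀ (by simp)
    obtain ⟨y₂, hy₂⟩ := right z A' ⟨hc', hz', y₀, hf⟩
    obtain rfl : y₀ = y₂ := hy₂.row_eq hf.ne_I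
    refine ⟨fun q => ?_, A', ⟨hc', hz', y₀, hf⟩, hx', hy₂, hmid⟩
    -- The last column of `A'` is a single `Y`. Multiplication by the `Z` of the bond makes it the
    -- `X` of `A`.
    rw [hlast, hy₂]
    split_ifs <;> simp [Pauli.mul]

end IsSolution

end

/-! ### Vertical bonds eliminate `X` and `Y` from the end columns -/

section
variable {L : ℕ}

theorem InWindow.act_vb {A : PauliProduct L} {x : ZMod L} {n i : ℕ} (h : InWindow A x n)
    (hi : i < n) (y : ZMod L) : InWindow (act (vb (sh x i) y) A) x n := by
  intro p q hpq
  rw [IsingSquare.act_vb] at hpq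
  split_ifs at hpq with hc
  · exact ⟨i, hi, by rcases hc with hc | hc <;> exact (Prod.mk.inj hc).1⟩
  · exact h p q hpq

theorem act_vb_chain_above [Fact (1 < L)] {x : ZMod L} {n : ℕ} {a b : Pauli} {y : ZMod L} {j : ℕ} :
    act (vb (sh x j) y) (chain x n a b y) (sh x j, y + 1) = .Z := by
  rw [act_vb]
  simp [chain, Pauli.mul]

theorem eq_hb_of_right [Fact (1 < L)] {T : Term L} {B : PauliProduct L} {x y : ZMod L} {n : ℕ}
    (hout : ∀ q, B (sh x (n + 2), q) = .I) (hs : sgn T B ≠ 0)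
    (hB : B (sh x (n + 1), y) ≠ .I) (hT : ¬ Occupied (act T B) (sh x (n + 1))) :
    T = hb (sh x n) y ∧ (B (sh x n, y)).FlipsZ := by
  obtain ⟨q, hq, h | h⟩ := exists_of_not_occupied_act hs ⟨y, hB⟩ hT
  · have h2 := h.2
    rw [sh_add_one, hout] at h2
    simp at h2
  · rw [sh_succ_sub_one] at h
    rwa [hq.row_eq hB]

theorem eq_hb_of_left [Fact (1 < L)] {T : Term L} {B : PauliProduct L} {x y : ZMod L}
    (hout : ∀ q, B (x - 1, q) = .I) (hs : sgn T B ≠ 0)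
    (hB : B (x, y) ≠ .I) (hT : ¬ Occupied (act T B) x) :
    T = hb x y := by
  obtain ⟨q, hq, h | h⟩ := exists_of_not_occupied_act hs ⟨y, hB⟩ hT
  · rw [hq.row_eq hB]
    exact h.1
  · have h2 := h.2
    rw [hout] at h2
    simp at h2

theorem act_vb_chain_sh {x : ZMod L} {n : ℕ} {a b : Pauli} {y : ZMod L} {i j : ℕ} (hi : i < L)
    (hj : j < L) : act (vb (sh x j) y) (chain x n a b y) (sh x i, y) =
      if i = j then Pauli.mul .Z (chainEntry n a b i) else chainEntry n a b i := by
  rw [act_vb, chain_sh hi]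
  by_cases h : i = j <;> simp [sh_inj hi hj, h]

section Chain
variable [NeZero L]

theorem act_fx_chain_left (x : ZMod L) (n : ℕ) (b : Pauli) (y : ZMod L) :
    act (fx x y) (chain x n .Z b y) = chain x n .Y b y := by
  funext ⟨p, q⟩
  obtain ⟨i, hi, rfl⟩ := exists_eq_sh x p
  rw [act_fx, chain_sh hi, chain_sh hi]
  rcases Nat.eq_zero_or_pos i with rfl | h0
  · by_cases hq : q = y <;> simp [hq, chainEntry, Pauli.mul]
  · simp [sh_ne_self hi h0, chainEntry, show i ≠ 0 by omega]

theorem act_fx_chain_right (x : ZMod L) {n : ℕ} (hn : 1 ≤ n) (hL : n < L) (a : Pauli)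
    (y : ZMod L) :
    act (fx (sh x n) y) (chain x (n + 1) a .Z y) = chain x (n + 1) a .Y y := by
  funext ⟨p, q⟩
  obtain ⟨i, hi, rfl⟩ := exists_eq_sh x p
  rw [act_fx, chain_sh hi, chain_sh hi]
  by_cases h0 : i = n
  · subst h0
    by_cases hq : q = y <;> simp [hq, chainEntry, Pauli.mul, show i ≠ 0 by omega]
  · simp [sh_ne hi hL h0, chainEntry, h0]

theorem act_hb_chain_right (x : ZMod L) {n : ℕ} (hn : 1 ≤ n) (hL : n + 1 < L) (a : Pauli)
    (y : ZMod L) :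
    act (hb (sh x n) y) (chain x (n + 1) a .Y y) = chain x (n + 2) a .Z y := by
  funext ⟨p, q⟩
  obtain ⟨i, hi, rfl⟩ := exists_eq_sh x p
  rw [act_hb, chain_sh hi, chain_sh hi, sh_add_one]
  simp only [Prod.mk.injEq, sh_inj hi (show n < L by omega), sh_inj hi hL, chainEntry]
  by_cases hq : q = y
  · by_cases h0 : i = 0
    · simp [h0, show 0 ≠ n by omega]
    by_cases h1 : i = n
    · simp [h1, hq, show n ≠ 0 by omega, Pauli.mul]
    by_cases h2 : i = n + 1
    · simp [h2, hq, Pauli.mul]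
    · simp [h0, h1, h2, show i < n + 1 ↔ i < n by omega]
  · simp [hq]

theorem act_hb_chain_left (x : ZMod L) {n : ℕ} (hn : 1 ≤ n) (hL : n + 1 < L) (b : Pauli)
    (y : ZMod L) :
    act (hb x y) (chain (sh x 1) (n + 1) .Y b y) = chain x (n + 2) .Z b y := by
  funext ⟨p, q⟩
  obtain ⟨i, hi, rfl⟩ := exists_eq_sh (sh x 1) p
  rw [act_hb, chain_sh hi, sh_one_sh, add_one_eq_sh]
  by_cases h : i + 1 < L
  · rw [chain_sh h]
    simp only [Prod.mk.injEq, sh_inj h (show 1 < L by omega), sh_ne_self h (by omega), chainEntry]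
    by_cases hq : q = y
    · by_cases h0 : i = 0
      · simp [h0, hq, show n ≠ 0 by omega, show 0 < n by omega, Pauli.mul]
      · simp [h0]
    · simp [hq]
  · have hx : sh x (i + 1) = x := by
      simp [sh, show i + 1 = L by omega]
    rw [hx, chain_self]
    by_cases hq : q = y
    · simp [hq, chainEntry, show i ≠ 0 by omega, show i ≠ n by omega, show ¬ i < n by omega,
        Pauli.mul]
    · simp [hq]

theorem act_vb_chain_self {x : ZMod L} {n : ℕ} {a b : Pauli} {y : ZMod L} {j : ℕ}
    (hj : j < L) : act (vb (sh x j) y) (chain x n a b y) (x, y) =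
      if j = 0 then Pauli.mul .Z a else a := by
  have := act_vb_chain_sh (x := x) (n := n) (a := a) (b := b) (y := y) (i := 0) (NeZero.pos L) hj
  simpa [chainEntry, eq_comm] using this

end Chain

variable [Fact (1 < L)] [NeZero L]

omit [NeZero L] in
/-- A term that maps the product of a vertical bond and a chain to a chain is that bond. -/
theorem eq_vb_of_act_eq_chain (hL : 3 ≤ L) {T : Term L} {x x' y y' : ZMod L} {n n' : ℕ}
    {a b a' b' : Pauli} {i : ℕ} (hi : i < L) (hx : x' = x) (hZ : chainEntry n' a' b' i ≠ .Z)
    (hne : Pauli.mul .Z (chainEntry n a b i) ≠ chainEntry n' a' b' i)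
    (hI : chainEntry n a b i ≠ .Z)
    (h : act T (act (vb (sh x i) y) (chain x n a b y)) = chain x' n' a' b' y') :
    T = vb (sh x i) y := by
  subst hx
  -- At both ends of the bond the entry is one that the target chain cannot have: in row `y` by
  -- `hne` and `hI`, in row `y + 1`, where it is `Z`, by `hZ`.
  apply eq_vb_of_act_ne hL (B := act (vb (sh x' i) y) (chain x' n a b y))
  · rw [h, chain_sh hi, act_vb_chain_sh hi hi, if_pos rfl]
    split_ifs
    · exact hne.symm
    · generalize chainEntry n a b i = e at hI
      cases e <;> simp_all [Pauli.mul]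
  · rw [h, chain_sh hi, act_vb_chain_above]
    split_ifs
    · exact hZ
    · simp

variable {m : ℕ} {J₁ J₂ hx hz : ℂ} {c : PauliProduct L → ℂ}

namespace IsSolution

/-- Products of maximal width with an `X` or `Y` in the first column are chains. -/
theorem eq_chain_of_flipsZ_left (S : IsSolution m J₁ J₂ hx hz c) {A : PauliProduct L}
    (hA : c A ≠ 0) {x y : ZMod L} (hl : (A (x, y)).FlipsZ) (hr : Occupied A (sh x (m + 1))) :
    ∃ y, A = chain x (m + 2) .Y .Z y := by
  have hm := S.one_le
  have hL := S.le_size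
  obtain ⟨z, rfl⟩ := exists_eq_sh_one x
  rw [sh_one_sh] at hr
  have hw := S.inWindow hA (occupied_of_flipsZ hl) (by simpa using hr)
  have hout := hw.left_eq_I (by omega) y
  rw [show sh z 1 - 1 = z by simp [sh]] at hout
  obtain ⟨y', -, hf, hc⟩ := S.exists_right_of_flipsZ_left hA hl hr
  have n1 : sh z (m + 1) ≠ z := sh_ne_self (by omega) (by omega)
  have n2 : z ≠ sh z (m + 2) := (sh_ne_self (by omega) (by omega)).symm
  -- The product shifted to the left has an `X` or `Y` in its last column, so its form is known.
  -- Undoing the two bonds recovers `A`.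
  set A' := act (hb (sh z (m + 1)) y') (act (hb z y) A) with hA'
  have h1 : A' (z, y) = .Z := by
    simp [hA', act_hb, hout, n1.symm, sh_add_one, n2, Pauli.mul]
  have h2 : (A' (sh z (m + 1), y')).FlipsZ := by
    rw [hA', act_hb, if_pos (Or.inl rfl)]
    apply Pauli.FlipsZ.mul_Z
    rw [act_hb]
    split_ifs
    · exact hf.mul_Z
    · exact hf
  obtain ⟨y₂, h⟩ := S.eq_chain_of_flipsZ_right hc ⟨y, by rw [h1]; simp⟩ h2
  have e1 : y = y₂ := by
    by_contra hne
    rw [h, chain_self, if_neg hne] at h1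
    simp at h1
  have e2 : y' = y₂ := by
    by_contra hne
    rw [h, chain_sh (by omega), if_neg hne] at h2
    simp at h2
  subst e1 e2
  refine ⟨y', ?_⟩
  rw [hA', ← act_comm] at h
  rw [← act_act (hb z y') (chain (sh z 1) (m + 2) .Y .Z y'),
    act_hb_chain_left z (by omega) (by omega), ← act_hb_chain_right z (by omega) (by omega),
    ← h, act_comm (hb z y') (hb (sh z (m + 1)) y')]
  simp

variable (S : IsSolution m J₁ J₂ hx hz c)
include S

/-- Equation of the chain `Z X ⋯ X Z` on `m + 3` columns: only the two end bonds shorten it. -/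
theorem chain_ZY_add_chain_YZ_shift (x y : ZMod L) :
    c (chain x (m + 2) .Z .Y y) + c (chain (sh x 1) (m + 2) .Y .Z y) = 0 := by
  have hm := S.one_le
  have hL := S.le_size
  have h := S.sum_finset_eq (chain x (m + 3) .Z .Z y) {hb x y, hb (sh x (m + 1)) y} ?_
  · rw [Finset.sum_pair (by simp [(sh_ne_self (x := x) (i := m + 1) (by omega) (by omega)).symm]),
      ← act_hb_chain_left x (by omega) (by omega), act_act,
      act_hb_chain_left x (by omega) (by omega), ← act_hb_chain_right x (by omega) (by omega),
      act_act, act_hb_chain_right x (by omega) (by omega)] at h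
    have s1 : sgn (hb x y) (chain x (m + 3) .Z .Z y) = -1 := by
      simp [sgn, chain_self, add_one_eq_sh x, chain_sh (show 1 < L by omega), chainEntry,
        Pauli.sgnZZ, Pauli.sgnZ]
    have s2 : sgn (hb (sh x (m + 1)) y) (chain x (m + 3) .Z .Z y) = -1 := by
      simp [sgn, sh_add_one, chain_sh (show m + 1 < L by omega),
        chain_sh (show m + 1 + 1 < L by omega), chainEntry, Pauli.sgnZZ, Pauli.sgnZ]
    rw [s1, s2] at h
    simp only [coupling] at h
    have := S.J₁_ne
    apply (mul_right_inj' this).1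
    push_cast at h
    linear_combination -h
  · intro T hs hc
    have hw := inWindow_chain x (n := m + 3) (by omega) .Z .Z y
    by_cases hk : Occupied (act T (chain x (m + 3) .Z .Z y)) x
    · have := eq_hb_of_right (n := m + 1) (y := y) (hw.eq_I le_rfl (by omega)) hs
        (by rw [chain_sh (by omega)]; simp [chainEntry]) (S.not_occupied hc hk)
      simp [this.1]
    · have := eq_hb_of_left (y := y) (hw.left_eq_I (by omega)) hs (by rw [chain_self]; simp) hk
      simp [this]

/-- Equation of `Y X ⋯ X Y`. A term other than the two end fields would leave `X` or `Y` at both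
ends, but a contributing product that ends in `X` or `Y` starts with `Z`. -/
theorem chain_ZY_add_chain_YZ (x y : ZMod L) :
    c (chain x (m + 2) .Z .Y y) + c (chain x (m + 2) .Y .Z y) = 0 := by
  have hm := S.one_le
  have hL := S.le_size
  have h := S.sum_finset_eq (chain x (m + 2) .Y .Y y) {fx x y, fx (sh x (m + 1)) y} ?_
  · rw [Finset.sum_pair (by simp [(sh_ne_self (x := x) (i := m + 1) (by omega) (by omega)).symm]),
      ← act_fx_chain_left x, act_act,
      act_fx_chain_left x, ← act_fx_chain_right x (by omega) (by omega),
      act_act, act_fx_chain_right x (by omega) (by omega)] at h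
    have s1 : sgn (fx x y) (chain x (m + 2) .Y .Y y) = -1 := by
      simp [sgn, chain_self, Pauli.sgnX]
    have s2 : sgn (fx (sh x (m + 1)) y) (chain x (m + 2) .Y .Y y) = -1 := by
      simp [sgn, chain_sh (show m + 1 < L by omega), chainEntry, Pauli.sgnX]
    rw [s1, s2] at h
    simp only [coupling] at h
    have := S.hx_ne
    apply (mul_right_inj' this).1
    push_cast at h
    linear_combination -h
  · intro T hs hc
    have hl : (chain x (m + 2) .Y .Y y (x, y)).FlipsZ := by simp [chain_self]
    have hr : (chain x (m + 2) .Y .Y y (sh x (m + 1), y)).FlipsZ := by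
      simp [chain_sh (show m + 1 < L by omega), chainEntry]
    by_cases h1 : (act T (chain x (m + 2) .Y .Y y) (x, y)).FlipsZ
    · by_cases h2 : (act T (chain x (m + 2) .Y .Y y) (sh x (m + 1), y)).FlipsZ
      · obtain ⟨y', h⟩ := S.eq_chain_of_flipsZ_right hc (occupied_of_flipsZ h1) h2
        rw [h, chain_self] at h1
        split_ifs at h1 <;> simp at h1
      · simp [(eq_fx_of_not_flipsZ_act hs hr h2).1]
    · simp [(eq_fx_of_not_flipsZ_act hs hl h1).1]

/-- Equation of `Y X ⋯ X Z` with a vertical bond at column `j`. A term may drop the last column or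
turn the left `Y` into `Z`. Otherwise the result is a chain, and the term is the vertical bond. For
`j = 0` the bond has made the left end an `X`, which commutes with the field. -/
theorem eq_act_vb_chain_YZ (x y : ZMod L) {j : ℕ} (hj : j ≤ m) :
    J₁ * (if j = m then 1 else -1) * c (act (vb (sh x j) y) (chain x (m + 1) .Y .Y y)) +
      hx * (if j = 0 then 0 else -1) * c (act (vb (sh x j) y) (chain x (m + 2) .Z .Z y)) +
      J₂ * (if j = 0 then -1 else 1) * c (chain x (m + 2) .Y .Z y) = 0 := by
  have hm := S.one_le
  have hL := S.le_size
  set B := act (vb (sh x j) y) (chain x (m + 2) .Y .Z y) with hB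
  have hBl : B (x, y) = if j = 0 then .X else .Y := by
    rw [hB, act_vb_chain_self (by omega)]; simp [Pauli.mul]
  have hBm : B (sh x m, y) = if j = m then .Y else .X := by
    rw [hB, act_vb_chain_sh (by omega) (by omega)]
    simp [chainEntry, show m ≠ 0 by omega, Pauli.mul, eq_comm]
  have hBr : B (sh x (m + 1), y) = .Z := by
    rw [hB, act_vb_chain_sh (by omega) (by omega)]
    simp [chainEntry, show m + 1 ≠ j by omega]
  have hBj : B (sh x j, y) = if j = 0 then .X else .Y := by
    rw [hB, act_vb_chain_sh (by omega) (by omega)]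
    by_cases h0 : j = 0
    · simp [chainEntry, Pauli.mul, h0]
    · simp [chainEntry, Pauli.mul, h0, show j ≠ m + 1 by omega, show j < m + 1 by omega]
  have h := S.sum_finset_eq B {hb (sh x m) y, fx x y, vb (sh x j) y} ?_
  · rw [Finset.sum_insert (by simp), Finset.sum_pair (by simp)] at h
    have c1 : act (hb (sh x m) y) B = act (vb (sh x j) y) (chain x (m + 1) .Y .Y y) := by
      rw [hB, act_comm, ← act_hb_chain_right x hm (by omega), act_act]
    have c2 : act (fx x y) B = act (vb (sh x j) y) (chain x (m + 2) .Z .Z y) := by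
      rw [hB, act_comm, ← act_fx_chain_left, act_act]
    have c3 : act (vb (sh x j) y) B = chain x (m + 2) .Y .Z y := by rw [hB, act_act]
    have s1 : sgn (hb (sh x m) y) B = if j = m then 1 else -1 := by
      simp only [sgn, sh_add_one, hBm, hBr]; split_ifs <;> rfl
    have s2 : sgn (fx x y) B = if j = 0 then 0 else -1 := by
      simp only [sgn, hBl]; split_ifs <;> rfl
    have s3 : sgn (vb (sh x j) y) B = if j = 0 then -1 else 1 := by
      simp only [sgn, hBj]; rw [hB, act_vb_chain_above]; split_ifs <;> rfl
    rw [c1, c2, c3, s1, s2, s3] at h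
    simp only [coupling] at h
    push_cast at h
    linear_combination h
  · intro T hs hc
    have hw : InWindow B x (m + 2) := (inWindow_chain x (by omega) _ _ y).act_vb (by omega) y
    have hl : (B (x, y)).FlipsZ := by rw [hBl]; split_ifs <;> simp
    by_cases hk : Occupied (act T B) (sh x (m + 1))
    · by_cases h1 : (act T B (x, y)).FlipsZ
      · obtain ⟨y', h⟩ := S.eq_chain_of_flipsZ_left hc h1 hk
        have : T = vb (sh x j) y := by
          refine eq_vb_of_act_eq_chain (by omega) (by omega) rfl ?_ ?_ ?_ h
          all_goals
            by_cases h0 : j = 0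
            · simp [chainEntry, Pauli.mul, h0]
            · simp [chainEntry, Pauli.mul, h0, show j ≠ m + 1 by omega, show j < m + 1 by omega]
        simp [this]
      · simp [(eq_fx_of_not_flipsZ_act hs hl h1).1]
    · simp [(eq_hb_of_right (hw.eq_I le_rfl (by omega)) hs (y := y) (by rw [hBr]; simp) hk).1]

theorem eq_act_vb_chain_ZY (z y : ZMod L) {j : ℕ} (hj : j ≤ m) :
    J₁ * (if j = 0 then 1 else -1) *
        c (act (vb (sh (sh z 1) j) y) (chain (sh z 1) (m + 1) .Y .Y y)) +
      hx * (if j = m then 0 else -1) * c (act (vb (sh z (j + 1)) y) (chain z (m + 2) .Z .Z y)) +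
      J₂ * (if j = m then -1 else 1) * c (chain z (m + 2) .Z .Y y) = 0 := by
  have hm := S.one_le
  have hL := S.le_size
  rw [sh_one_sh]
  set B := act (vb (sh z (j + 1)) y) (chain z (m + 2) .Z .Y y) with hB
  have hBl : B (z, y) = .Z := by
    rw [hB, act_vb_chain_self (by omega)]; simp
  have hBm : B (sh z 1, y) = if j = 0 then .Y else .X := by
    rw [hB, act_vb_chain_sh (by omega) (by omega)]
    simp [chainEntry, show m ≠ 0 by omega, show 0 < m by omega, Pauli.mul, eq_comm]
  have hBj : B (sh z (j + 1), y) = if j = m then .X else .Y := by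
    rw [hB, act_vb_chain_sh (by omega) (by omega)]
    by_cases h0 : j = m
    · simp [chainEntry, Pauli.mul, h0]
    · simp [chainEntry, Pauli.mul, h0, show j < m by omega]
  have hBr : B (sh z (m + 1), y) = if j = m then .X else .Y := by
    rw [hB, act_vb_chain_sh (by omega) (by omega)]
    simp [chainEntry, Pauli.mul, eq_comm]
  have h := S.sum_finset_eq B {hb z y, fx (sh z (m + 1)) y, vb (sh z (j + 1)) y} ?_
  · rw [Finset.sum_insert (by simp), Finset.sum_pair (by simp)] at h
    have c1 : act (hb z y) B = act (vb (sh z (j + 1)) y) (chain (sh z 1) (m + 1) .Y .Y y) := by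
      rw [hB, act_comm, ← act_hb_chain_left z hm (by omega), act_act]
    have c2 : act (fx (sh z (m + 1)) y) B =
        act (vb (sh z (j + 1)) y) (chain z (m + 2) .Z .Z y) := by
      rw [hB, act_comm, ← act_fx_chain_right z (by omega) (by omega), act_act]
    have c3 : act (vb (sh z (j + 1)) y) B = chain z (m + 2) .Z .Y y := by rw [hB, act_act]
    have s1 : sgn (hb z y) B = if j = 0 then 1 else -1 := by
      simp only [sgn, add_one_eq_sh z, hBm, hBl]; split_ifs <;> rfl
    have s2 : sgn (fx (sh z (m + 1)) y) B = if j = m then 0 else -1 := by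
      simp only [sgn, hBr]; split_ifs <;> rfl
    have s3 : sgn (vb (sh z (j + 1)) y) B = if j = m then -1 else 1 := by
      simp only [sgn, hBj]; rw [hB, act_vb_chain_above]; split_ifs <;> rfl
    rw [c1, c2, c3, s1, s2, s3] at h
    simp only [coupling] at h
    push_cast at h
    linear_combination h
  · intro T hs hc
    have hw : InWindow B z (m + 2) := (inWindow_chain z (by omega) _ _ y).act_vb (by omega) y
    have hr : (B (sh z (m + 1), y)).FlipsZ := by rw [hBr]; split_ifs <;> simp
    by_cases hk : Occupied (act T B) z
    · by_cases h1 : (act T B (sh z (m + 1), y)).FlipsZ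
      · obtain ⟨y', h⟩ := S.eq_chain_of_flipsZ_right hc hk h1
        have : T = vb (sh z (j + 1)) y := by
          refine eq_vb_of_act_eq_chain (by omega) (by omega) rfl ?_ ?_ ?_ h
          all_goals
            by_cases h0 : j = m
            · simp [chainEntry, Pauli.mul, h0]
            · simp [chainEntry, Pauli.mul, h0, show j < m by omega]
        simp [this]
      · simp [(eq_fx_of_not_flipsZ_act hs hr h1).1]
    · simp [eq_hb_of_left (hw.left_eq_I (by omega)) hs (y := y) (by rw [hBl]; simp) hk]

theorem chain_YZ_shift (x y : ZMod L) :
    c (chain (sh x 1) (m + 2) .Y .Z y) = c (chain x (m + 2) .Y .Z y) := by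
  linear_combination S.chain_ZY_add_chain_YZ_shift x y - S.chain_ZY_add_chain_YZ x y

/-- The two preceding families share the decorated chain `Y X ⋯ X Y` on `m + 1` columns. Eliminating
it moves the chain `Z X ⋯ X Z` one column under the fixed bond, at the cost of `-2 * J₂` times a
translation invariant coefficient. -/
theorem act_vb_chain_ZZ_of_chain_YZ (y : ZMod L) {i : ℕ} (hi : i < m) : ∀ x : ZMod L,
    hx * c (act (vb (sh x (i + 1)) y) (chain x (m + 2) .Z .Z y)) =
      -2 * (i + 1) * J₂ * c (chain x (m + 2) .Y .Z y) := by
  induction i with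
  | zero =>
    intro x
    have e3 := S.eq_act_vb_chain_YZ (sh x 1) y (j := 0) (by omega)
    have e4 := S.eq_act_vb_chain_ZY x y (j := 0) (by omega)
    have h1 := S.chain_YZ_shift x y
    have h2 := S.chain_ZY_add_chain_YZ x y
    simp only [if_true, show ¬ (0 = m) by omega, if_false] at e3 e4
    push_cast
    linear_combination -e3 - e4 + J₂ * h2 - J₂ * h1
  | succ i ih =>
    intro x
    have e3 := S.eq_act_vb_chain_YZ (sh x 1) y (j := i + 1) (by omega)
    have e4 := S.eq_act_vb_chain_ZY x y (j := i + 1) (by omega)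
    have h1 := S.chain_YZ_shift x y
    have h2 := S.chain_ZY_add_chain_YZ x y
    have h3 := ih (by omega) (sh x 1)
    simp only [show ¬ (i + 1 = 0) by omega, show ¬ (i + 1 = m) by omega, if_false] at e3 e4
    push_cast
    linear_combination e3 - e4 + J₂ * h2 + h3 + (-2 * (i + 1) * J₂ - J₂) * h1

theorem chain_YZ_eq_zero (x y : ZMod L) : c (chain x (m + 2) .Y .Z y) = 0 := by
  have hm := S.one_le
  obtain ⟨z, rfl⟩ := exists_eq_sh_one x
  obtain ⟨n, rfl⟩ : ∃ n, m = n + 1 := ⟨m - 1, by omega⟩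
  have h := S.act_vb_chain_ZZ_of_chain_YZ y (i := n) (by omega) (sh z 1)
  have e3 := S.eq_act_vb_chain_YZ (sh z 1) y (j := n + 1) (by omega)
  have e4 := S.eq_act_vb_chain_ZY z y (j := n + 1) (by omega)
  have h1 := S.chain_YZ_shift z y
  have h2 := S.chain_ZY_add_chain_YZ z y
  simp only [show ¬ (n + 1 = 0) by omega, if_true, if_false] at e3 e4
  -- At `j = m` the next field contribution has coefficient zero, which closes the recursion. Each
  -- of the `2 * (m + 1)` equations has contributed one `J₂`.
  have key : (2 * (n + 2) * J₂) * c (chain (sh z 1) (n + 1 + 2) .Y .Z y) = 0 := by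
    linear_combination e3 + e4 + h + J₂ * h2 + J₂ * h1
  have hn : (n : ℂ) + 2 ≠ 0 := by exact_mod_cast (show n + 2 ≠ 0 by omega)
  exact (mul_eq_zero.1 key).resolve_left (mul_ne_zero (mul_ne_zero two_ne_zero hn) S.J₂_ne)

theorem chain_ZY_eq_zero (x y : ZMod L) : c (chain x (m + 2) .Z .Y y) = 0 := by
  linear_combination S.chain_ZY_add_chain_YZ x y - S.chain_YZ_eq_zero x y

theorem not_flipsZ_left {A : PauliProduct L} (hA : c A ≠ 0) {x : ZMod L}
    (hr : Occupied A (sh x (m + 1))) (y : ZMod L) : ¬ (A (x, y)).FlipsZ := by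
  intro hl
  obtain ⟨y', rfl⟩ := S.eq_chain_of_flipsZ_left hA hl hr
  exact hA (S.chain_YZ_eq_zero x y')

theorem not_flipsZ_right {A : PauliProduct L} (hA : c A ≠ 0) {x : ZMod L}
    (hl : Occupied A x) (y : ZMod L) : ¬ (A (sh x (m + 1), y)).FlipsZ := by
  intro hr
  obtain ⟨y', rfl⟩ := S.eq_chain_of_flipsZ_right hA hl hr
  exact hA (S.chain_ZY_eq_zero x y')

end IsSolution

end

/-! ### Products of maximal width with only `Z` at both ends -/

section
variable {L : ℕ} [Fact (1 < L)] [NeZero L] {m : ℕ} {J₁ J₂ hx hz : ℂ} {c : PauliProduct L → ℂ}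

namespace IsSolution

variable (S : IsSolution m J₁ J₂ hx hz c)
include S

/-- Turn a `Z` of the first column into `Y`. A different term that kept the last column occupied
would leave a product excluded by `not_flipsZ_left`, so the cancelling term empties that column. -/
theorem exists_colIs_right {A : PauliProduct L} (hA : c A ≠ 0) {x : ZMod L}
    (hl : Occupied A x) (hr : Occupied A (sh x (m + 1))) : ∃ y, ColIs A (sh x (m + 1)) .Z y := by
  have hL := S.le_size
  obtain ⟨y, hy⟩ := id hl
  have hZ : A (x, y) = .Z := by
    have := S.not_flipsZ_left hA hr y
    generalize A (x, y) = a at *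
    cases a <;> simp_all
  have n1 : sh x (m + 1) ≠ x := sh_ne_self (by omega) (by omega)
  set B := act (fx x y) A with hB
  have hBl : B (x, y) = .Y := by simp [hB, act_fx, hZ, Pauli.mul]
  have hBr : ∀ q, B (sh x (m + 1), q) = A (sh x (m + 1), q) := by
    intro q; simp [hB, act_fx, n1]
  obtain ⟨T, hne, hs, hc⟩ := S.exists_ne_term (T := fx x y) (B := B) (by simp)
    (by simp [sgn, hBl, Pauli.sgnX]) (by rwa [hB, act_act])
  have hrB : Occupied B (sh x (m + 1)) := by
    obtain ⟨q, hq⟩ := hr; exact ⟨q, by rwa [hBr]⟩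
  by_cases hk : Occupied (act T B) (sh x (m + 1))
  · exact absurd (eq_fx_of_not_flipsZ_act hs (by simp [hBl]) (S.not_flipsZ_left hc hk y)).1 hne
  · obtain ⟨q, hq, -⟩ := exists_of_not_occupied_act hs hrB hk
    exact ⟨q, fun r => by rw [← hBr, hq]⟩

theorem exists_colIs_left {A : PauliProduct L} (hA : c A ≠ 0) {x : ZMod L}
    (hl : Occupied A x) (hr : Occupied A (sh x (m + 1))) : ∃ y, ColIs A x .Z y := by
  have hL := S.le_size
  obtain ⟨y, hy⟩ := id hr
  have hZ : A (sh x (m + 1), y) = .Z := by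
    have := S.not_flipsZ_right hA hl y
    generalize A (sh x (m + 1), y) = a at *
    cases a <;> simp_all
  have n1 : x ≠ sh x (m + 1) := (sh_ne_self (by omega) (by omega)).symm
  set B := act (fx (sh x (m + 1)) y) A with hB
  have hBr : B (sh x (m + 1), y) = .Y := by simp [hB, act_fx, hZ, Pauli.mul]
  have hBl : ∀ q, B (x, q) = A (x, q) := by
    intro q; simp [hB, act_fx, n1]
  obtain ⟨T, hne, hs, hc⟩ := S.exists_ne_term (T := fx (sh x (m + 1)) y) (B := B) (by simp)
    (by simp [sgn, hBr, Pauli.sgnX]) (by rwa [hB, act_act])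
  have hlB : Occupied B x := by
    obtain ⟨q, hq⟩ := hl; exact ⟨q, by rwa [hBl]⟩
  by_cases hk : Occupied (act T B) x
  · exact absurd (eq_fx_of_not_flipsZ_act hs (by simp [hBr]) (S.not_flipsZ_right hc hk y)).1 hne
  · obtain ⟨q, hq, -⟩ := exists_of_not_occupied_act hs hlB hk
    exact ⟨q, fun r => by rw [← hBl, hq]⟩

/-- The shift now takes two equations and passes through a product with `X` or `Y` at both ends of
`m + 1` columns, since maximal width with such an end is excluded. -/
theorem exists_shift {A : PauliProduct L} (hA : c A ≠ 0) {z y y₀ : ZMod L}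
    (hl : ColIs A (sh z 1) .Z y) (hr : ColIs A (sh z (m + 2)) .Z y₀) :
    ColIs A (sh z (m + 1)) .X y₀ ∧ ∃ A', (c A' ≠ 0 ∧ Occupied A' z ∧ Occupied A' (sh z (m + 1))) ∧
      ColIs A' (sh z 1) .X y ∧ ColIs A' (sh z (m + 1)) .Z y₀ ∧
      ∀ i, 2 ≤ i → i ≤ m → ∀ q, A' (sh z i, q) = A (sh z i, q) := by
  have hm := S.one_le
  have hL := S.le_size
  have n1 : z ≠ sh z 1 := (sh_ne_self (by omega) (by omega)).symm
  have n2 : sh z (m + 2) ≠ z := sh_ne_self (by omega) (by omega)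
  have n3 : sh z (m + 2) ≠ sh z 1 := sh_ne (by omega) (by omega) (by omega)
  have n4 : sh z (m + 1) ≠ z := sh_ne_self (by omega) (by omega)
  have n5 : sh z (m + 1) ≠ sh z 1 := sh_ne (by omega) (by omega) (by omega)
  have n6 : sh z (m + 3) ≠ sh z 1 := sh_ne (by omega) (by omega) (by omega)
  have n7 : z - 1 ≠ z := by simp
  have n8 : z - 1 ≠ sh z 1 := by rw [sub_one_eq_sh]; exact sh_ne (by omega) (by omega) (by omega)
  have n9 : z - 1 ≠ sh z (m + 1) := by
    rw [sub_one_eq_sh]; exact sh_ne (by omega) (by omega) (by omega)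
  have n10 : z - 1 ≠ sh z (m + 2) := by
    rw [sub_one_eq_sh]; exact sh_ne (by omega) (by omega) (by omega)
  have hw := S.inWindow hA (hl.occupied (by simp)) (by simpa using hr.occupied (by simp))
  have hout : ∀ q, A (z, q) = .I := by
    intro q
    have := hw.left_eq_I (by omega) q
    rwa [show sh z 1 - 1 = z by simp [sh]] at this
  have hout' : ∀ q, A (z - 1, q) = .I := by
    intro q
    have := hw.eq_I (i := L - 2) (by omega) (by omega) q
    rwa [sh_one_sh, show L - 2 + 1 = L - 1 by omega, ← sub_one_eq_sh] at this
  have hout3 : ∀ q, A (sh z (m + 3), q) = .I := by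
    intro q
    have := hw.eq_I (i := m + 2) (by omega) (by omega) q
    rwa [sh_one_sh] at this
  -- removing the last column
  set B := act (fx (sh z 1) y) A with hB
  have eB : ∀ s, B s = if s = (sh z 1, y) then Pauli.mul .X (A s) else A s := by
    intro s; rw [hB, act_fx]
  have hBl : B (sh z 1, y) = .Y := by simp [eB, hl.eq, Pauli.mul]
  obtain ⟨T, hne, hs, hc⟩ := S.exists_ne_term (T := fx (sh z 1) y) (B := B) (by simp)
    (by simp [sgn, hBl, Pauli.sgnX]) (by rwa [hB, act_act])
  have hk : ¬ Occupied (act T B) (sh z (m + 2)) := fun hk =>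
    hne (eq_fx_of_not_flipsZ_act hs (by simp [hBl])
      (S.not_flipsZ_left hc (by rwa [sh_one_sh]) y)).1
  obtain ⟨hT, hf⟩ := eq_hb_of_right (x := z) (n := m + 1) (y := y₀)
    (fun q => by simp [eB, n6, hout3]) hs (by simp [eB, n3, hr.eq]) hk
  set C := act T B with hC
  have eC : ∀ s, C s = if s = (sh z (m + 1), y₀) ∨ s = (sh z (m + 2), y₀) then
      Pauli.mul .Z (B s) else B s := by
    intro s; rw [hC, hT, act_hb, sh_add_one]
  -- adding a column on the left
  set D := act (hb z y) C with hD
  have eD : ∀ s, D s = if s = (z, y) ∨ s = (sh z 1, y) then Pauli.mul .Z (C s) else C s := by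
    intro s; rw [hD, act_hb, add_one_eq_sh]
  have hDl : D (z, y) = .Z := by
    simp [eD, eC, eB, n1, n2.symm, n4.symm, hout, Pauli.mul]
  have hD1 : D (sh z 1, y) = .X := by
    simp [eD, eC, eB, n3.symm, n5.symm, hl.eq, Pauli.mul]
  have hDr : (D (sh z (m + 1), y₀)).FlipsZ := by
    simpa [eD, eC, n4, n5] using hf.mul_Z
  obtain ⟨T', hne', hs', hc'⟩ := S.exists_ne_term (T := hb z y) (B := D) (by simp)
    (sgn_hb_ne_zero (by rw [hDl, add_one_eq_sh, hD1]; simp)) (by rwa [hD, act_act])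
  have hl' : Occupied (act T' D) z := by
    by_contra hk
    exact hne' (eq_hb_of_left (fun q => by simp [eD, eC, eB, n7, n8, n9, n10, hout']) hs'
      (by simp [hDl]) hk)
  have hr' : Occupied (act T' D) (sh z (m + 1)) := occupied_act_of_flipsZ hs' hDr
  obtain ⟨hT', hY⟩ := eq_fx_of_not_flipsZ_act hs' hDr (S.not_flipsZ_right hc' hl' y₀)
  have e1 : ∀ s, act T' D s = if s = (sh z (m + 1), y₀) then Pauli.mul .X (D s) else D s := by
    intro s; rw [hT', act_fx]
  obtain ⟨y₁, hy₁⟩ := S.exists_colIs_right hc' hl' hr'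
  obtain rfl : y₀ = y₁ := hy₁.row_eq (by simp [e1, hY, Pauli.mul])
  refine ⟨fun q => ?_, _, ⟨hc', hl', hr'⟩, fun q => ?_, hy₁, fun i h2 him q => ?_⟩
  · by_cases hq : q = y₀
    · subst hq
      simp only [eD, eC, eB, n4, n5, Prod.mk.injEq, false_and, or_false, if_false,
        true_or, if_true] at hY
      generalize A (sh z (m + 1), q) = a at *
      cases a <;> simp_all [Pauli.mul]
    · have := hy₁ q
      simpa [e1, eD, eC, eB, n4, n5, hq] using this
  · simp only [e1, eD, eC, eB, n5.symm, n3.symm, n1.symm, Prod.mk.injEq, false_and, or_false,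
      if_false, false_or, true_and, hl q]
    split_ifs <;> simp_all [Pauli.mul]
  · have i1 : sh z i ≠ sh z 1 := sh_ne (by omega) (by omega) (by omega)
    have i2 : sh z i ≠ sh z (m + 1) := sh_ne (by omega) (by omega) (by omega)
    have i3 : sh z i ≠ sh z (m + 2) := sh_ne (by omega) (by omega) (by omega)
    have i4 : sh z i ≠ z := sh_ne_self (by omega) (by omega)
    simp [e1, eD, eC, eB, i1, i2, i3, i4]

/-- All products of maximal width are chains. -/
theorem eq_chain {A : PauliProduct L} (hA : c A ≠ 0) {x : ZMod L}
    (hl : Occupied A x) (hr : Occupied A (sh x (m + 1))) :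
    ∃ y, A = chain x (m + 2) .Z .Z y := by
  refine eq_chain_of_shift S.one_le
    (fun x A => c A ≠ 0 ∧ Occupied A x ∧ Occupied A (sh x (m + 1))) ?_ ?_ ?_ ?_ x A ⟨hA, hl, hr⟩
  · rintro x A ⟨hc, hl, hr⟩
    exact S.inWindow hc hl hr
  · rintro x A ⟨hc, hl, hr⟩
    exact S.exists_colIs_left hc hl hr
  · rintro x A ⟨hc, hl, hr⟩
    exact S.exists_colIs_right hc hl hr
  · rintro z A y y₀ ⟨hc, -, -⟩ h h₀
    exact S.exists_shift hc h h₀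

/-- Products with an `X` or `Y` at both ends of `m + 1` columns are chains. -/
theorem eq_chain_of_flipsZ_of_flipsZ {C : PauliProduct L} (hC : c C ≠ 0) {x y₀ y₁ : ZMod L}
    (hl : (C (x, y₀)).FlipsZ) (hr : (C (sh x m, y₁)).FlipsZ) :
    ∃ y, C = chain x (m + 1) .Y .Y y := by
  have hm := S.one_le
  have hL := S.le_size
  obtain ⟨z, rfl⟩ := exists_eq_sh_one x
  rw [sh_one_sh] at hr
  have n4 : sh z (m + 1) ≠ z := sh_ne_self (by omega) (by omega)
  have n5 : sh z (m + 1) ≠ sh z 1 := sh_ne (by omega) (by omega) (by omega)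
  have n7 : z - 1 ≠ z := by simp
  have n8 : z - 1 ≠ sh z 1 := by rw [sub_one_eq_sh]; exact sh_ne (by omega) (by omega) (by omega)
  have hout : ∀ q, C (z, q) = .I := by
    intro q
    by_contra h
    exact S.not_flipsZ_right hC ⟨q, h⟩ y₁ hr
  have hout' : ∀ q, C (z - 1, q) = .I := by
    intro q
    by_contra h
    refine S.not_occupied hC ⟨q, h⟩ ?_
    rw [show sh (z - 1) (m + 2) = sh z (m + 1) by simp only [sh]; push_cast; ring]
    exact occupied_of_flipsZ hr
  -- With a bond attached on the left, the only other term is the field at the right end. It leads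
  -- to a product of maximal width, known to be a chain.
  set B := act (hb z y₀) C with hB
  have eB : ∀ s, B s = if s = (z, y₀) ∨ s = (sh z 1, y₀) then Pauli.mul .Z (C s) else C s := by
    intro s; rw [hB, act_hb, add_one_eq_sh]
  have hBl : B (z, y₀) = .Z := by simp [eB, hout, Pauli.mul]
  have hBr : (B (sh z (m + 1), y₁)).FlipsZ := by simpa [eB, n4, n5] using hr
  have hB1 : (B (sh z 1, y₀)).FlipsZ := by simpa [eB] using hl.mul_Z
  obtain ⟨T, hne, hs, hc⟩ := S.exists_ne_term (T := hb z y₀) (B := B) (by simp)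
    (sgn_hb_ne_zero (by rw [hBl, add_one_eq_sh]; simpa using hB1)) (by rwa [hB, act_act])
  have hl' : Occupied (act T B) z := by
    by_contra hk
    exact hne (eq_hb_of_left (fun q => by simp [eB, n7, n8, hout']) hs (by simp [hBl]) hk)
  obtain ⟨hT, hY⟩ := eq_fx_of_not_flipsZ_act hs hBr (S.not_flipsZ_right hc hl' y₁)
  obtain ⟨y, hy⟩ := S.eq_chain hc hl' (occupied_act_of_flipsZ hs hBr)
  have h1 : y₁ = y := by
    by_contra h
    have h2 : act T B (sh z (m + 1), y₁) = .Z := by simp [hT, act_fx, hY, Pauli.mul]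
    rw [hy, chain_sh (by omega), if_neg h] at h2
    simp at h2
  subst h1
  have hB2 : B = chain z (m + 2) .Z .Y y₁ := by
    rw [← act_fx_chain_right z (by omega) (by omega), ← hy, hT, act_act]
  have h0 : y₀ = y₁ := by
    by_contra h
    rw [hB2, chain_self, if_neg h] at hBl
    simp at hBl
  subst h0
  refine ⟨y₀, ?_⟩
  rw [← act_act (hb z y₀) (chain (sh z 1) (m + 1) .Y .Y y₀), act_hb_chain_left z hm (by omega),
    ← hB2, hB, act_act]

/-- Equation of `Y X ⋯ X Z`, whose own coefficient is already known to vanish. With its mirror image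
`chain_ZZ_eq_shift` it gives translation invariance. -/
theorem chain_ZZ_eq (x y : ZMod L) :
    hx * c (chain x (m + 2) .Z .Z y) + J₁ * c (chain x (m + 1) .Y .Y y) = 0 := by
  have hm := S.one_le
  have hL := S.le_size
  set B := chain x (m + 2) .Y .Z y with hB
  have hBl : B (x, y) = .Y := by simp [hB, chain_self]
  have hBm : B (sh x m, y) = .X := by
    rw [hB, chain_sh (by omega)]; simp [chainEntry, show m ≠ 0 by omega]
  have hBr : B (sh x (m + 1), y) = .Z := by
    rw [hB, chain_sh (by omega)]; simp [chainEntry]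
  have h := S.sum_finset_eq B {fx x y, hb (sh x m) y} ?_
  · rw [Finset.sum_pair (by simp)] at h
    have c1 : act (fx x y) B = chain x (m + 2) .Z .Z y := by
      rw [hB, ← act_fx_chain_left, act_act]
    have c2 : act (hb (sh x m) y) B = chain x (m + 1) .Y .Y y := by
      rw [hB, ← act_hb_chain_right x hm (by omega), act_act]
    have s1 : sgn (fx x y) B = -1 := by simp only [sgn, hBl]; rfl
    have s2 : sgn (hb (sh x m) y) B = -1 := by simp only [sgn, sh_add_one, hBm, hBr]; rfl
    rw [c1, c2, s1, s2] at h
    simp only [coupling] at h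
    push_cast at h
    linear_combination -h
  · intro T hs hc
    have hw : InWindow B x (m + 2) := inWindow_chain x (by omega) _ _ y
    by_cases hk : Occupied (act T B) (sh x (m + 1))
    · simp [(eq_fx_of_not_flipsZ_act hs (by simp [hBl]) (S.not_flipsZ_left hc hk y)).1]
    · simp [(eq_hb_of_right (hw.eq_I le_rfl (by omega)) hs (y := y) (by rw [hBr]; simp) hk).1]

theorem chain_ZZ_eq_shift (z y : ZMod L) :
    hx * c (chain z (m + 2) .Z .Z y) + J₁ * c (chain (sh z 1) (m + 1) .Y .Y y) = 0 := by
  have hm := S.one_le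
  have hL := S.le_size
  set B := chain z (m + 2) .Z .Y y with hB
  have hBl : B (z, y) = .Z := by simp [hB, chain_self]
  have hBm : B (sh z 1, y) = .X := by
    rw [hB, chain_sh (by omega)]; simp [chainEntry, show m ≠ 0 by omega, show 0 < m by omega]
  have hBr : B (sh z (m + 1), y) = .Y := by
    rw [hB, chain_sh (by omega)]; simp [chainEntry]
  have h := S.sum_finset_eq B {fx (sh z (m + 1)) y, hb z y} ?_
  · rw [Finset.sum_pair (by simp)] at h
    have c1 : act (fx (sh z (m + 1)) y) B = chain z (m + 2) .Z .Z y := by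
      rw [hB, ← act_fx_chain_right z (by omega) (by omega), act_act]
    have c2 : act (hb z y) B = chain (sh z 1) (m + 1) .Y .Y y := by
      rw [hB, ← act_hb_chain_left z hm (by omega), act_act]
    have s1 : sgn (fx (sh z (m + 1)) y) B = -1 := by simp only [sgn, hBr]; rfl
    have s2 : sgn (hb z y) B = -1 := by simp only [sgn, add_one_eq_sh z, hBm, hBl]; rfl
    rw [c1, c2, s1, s2] at h
    simp only [coupling] at h
    push_cast at h
    linear_combination -h
  · intro T hs hc
    have hw : InWindow B z (m + 2) := inWindow_chain z (by omega) _ _ y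
    by_cases hk : Occupied (act T B) z
    · simp [(eq_fx_of_not_flipsZ_act hs (by simp [hBr]) (S.not_flipsZ_right hc hk y)).1]
    · simp [eq_hb_of_left (hw.left_eq_I (by omega)) hs (y := y) (by rw [hBl]; simp) hk]

theorem chain_ZZ_shift (x y : ZMod L) :
    c (chain (sh x 1) (m + 2) .Z .Z y) = c (chain x (m + 2) .Z .Z y) := by
  apply mul_left_cancel₀ S.hx_ne
  linear_combination S.chain_ZZ_eq (sh x 1) y - S.chain_ZZ_eq_shift x y

/-- With the bond at an interior column, a term drops the first or the last column, or else is the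
bond itself. -/
theorem eq_act_vb_chain_ZZ (x y : ZMod L) {j : ℕ} (hj : j < m) :
    J₁ * (if j = 0 then 1 else -1) *
        c (act (vb (sh (sh x 1) j) y) (chain (sh x 1) (m + 1) .Y .Z y)) +
      J₁ * (if j + 1 = m then 1 else -1) *
        c (act (vb (sh x (j + 1)) y) (chain x (m + 1) .Z .Y y)) +
      J₂ * c (chain x (m + 2) .Z .Z y) = 0 := by
  have hm := S.one_le
  have hL := S.le_size
  rw [sh_one_sh]
  set B := act (vb (sh x (j + 1)) y) (chain x (m + 2) .Z .Z y) with hB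
  have hBl : B (x, y) = .Z := by
    rw [hB, act_vb_chain_self (by omega)]; simp
  have hB1 : B (sh x 1, y) = if j = 0 then .Y else .X := by
    rw [hB, act_vb_chain_sh (by omega) (by omega)]
    simp [chainEntry, show m ≠ 0 by omega, show 0 < m by omega, Pauli.mul, eq_comm]
  have hBm : B (sh x m, y) = if j + 1 = m then .Y else .X := by
    rw [hB, act_vb_chain_sh (by omega) (by omega)]
    simp [chainEntry, show m ≠ 0 by omega, Pauli.mul, eq_comm]
  have hBr : B (sh x (m + 1), y) = .Z := by
    rw [hB, act_vb_chain_sh (by omega) (by omega)]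
    simp [chainEntry, show m ≠ j by omega]
  have hBj : B (sh x (j + 1), y) = .Y := by
    rw [hB, act_vb_chain_sh (by omega) (by omega)]
    simp [chainEntry, Pauli.mul, show j ≠ m by omega, show j < m by omega]
  have hne : hb x y ≠ hb (sh x m) y := by
    simp [(sh_ne_self (x := x) (i := m) (by omega) (by omega)).symm]
  have h := S.sum_finset_eq B {hb x y, hb (sh x m) y, vb (sh x (j + 1)) y} ?_
  · rw [Finset.sum_insert (by simpa using hne), Finset.sum_pair (by simp)] at h
    have c1 : act (hb x y) B = act (vb (sh x (j + 1)) y) (chain (sh x 1) (m + 1) .Y .Z y) := by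
      rw [hB, act_comm, ← act_hb_chain_left x hm (by omega), act_act]
    have c2 : act (hb (sh x m) y) B = act (vb (sh x (j + 1)) y) (chain x (m + 1) .Z .Y y) := by
      rw [hB, act_comm, ← act_hb_chain_right x hm (by omega), act_act]
    have c3 : act (vb (sh x (j + 1)) y) B = chain x (m + 2) .Z .Z y := by rw [hB, act_act]
    have s1 : sgn (hb x y) B = if j = 0 then 1 else -1 := by
      simp only [sgn, add_one_eq_sh x, hB1, hBl]; split_ifs <;> rfl
    have s2 : sgn (hb (sh x m) y) B = if j + 1 = m then 1 else -1 := by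
      simp only [sgn, sh_add_one, hBm, hBr]; split_ifs <;> rfl
    have s3 : sgn (vb (sh x (j + 1)) y) B = 1 := by
      simp only [sgn, hBj]; rw [hB, act_vb_chain_above]; rfl
    rw [c1, c2, c3, s1, s2, s3] at h
    simp only [coupling] at h
    push_cast at h
    linear_combination h
  · intro T hs hc
    have hw : InWindow B x (m + 2) := (inWindow_chain x (by omega) _ _ y).act_vb (by omega) y
    by_cases hk : Occupied (act T B) x
    · by_cases hk' : Occupied (act T B) (sh x (m + 1))
      · obtain ⟨y', h⟩ := S.eq_chain hc hk hk'
        have : T = vb (sh x (j + 1)) y := by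
          refine eq_vb_of_act_eq_chain (by omega) (by omega) rfl ?_ ?_ ?_ h
          all_goals
            simp [chainEntry, Pauli.mul, show j ≠ m by omega, show j < m by omega]
        simp [this]
      · simp [(eq_hb_of_right (hw.eq_I le_rfl (by omega)) hs (y := y) (by rw [hBr]; simp) hk').1]
    · simp [eq_hb_of_left (hw.left_eq_I (by omega)) hs (y := y) (by rw [hBl]; simp) hk]

/-- Any term other than the two end fields keeps `X` or `Y` at both ends, so
`eq_chain_of_flipsZ_of_flipsZ` identifies it as the vertical bond. -/
theorem eq_act_vb_chain_YY (x y : ZMod L) {j : ℕ} (hj : j ≤ m) :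
    hx * (if j = 0 then 0 else -1) * c (act (vb (sh x j) y) (chain x (m + 1) .Z .Y y)) +
      hx * (if j = m then 0 else -1) * c (act (vb (sh x j) y) (chain x (m + 1) .Y .Z y)) +
      J₂ * (if j = 0 ∨ j = m then -1 else 1) * c (chain x (m + 1) .Y .Y y) = 0 := by
  have hm := S.one_le
  have hL := S.le_size
  set B := act (vb (sh x j) y) (chain x (m + 1) .Y .Y y) with hB
  have hBl : B (x, y) = if j = 0 then .X else .Y := by
    rw [hB, act_vb_chain_self (by omega)]; simp [Pauli.mul]
  have hBr : B (sh x m, y) = if j = m then .X else .Y := by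
    rw [hB, act_vb_chain_sh (by omega) (by omega)]
    simp [chainEntry, Pauli.mul, eq_comm]
  have hBj : B (sh x j, y) = if j = 0 ∨ j = m then .X else .Y := by
    rw [hB, act_vb_chain_sh (by omega) (by omega)]
    by_cases h0 : j = 0
    · simp [chainEntry, Pauli.mul, h0]
    · by_cases h1 : j = m
      · simp [chainEntry, Pauli.mul, h1]
      · simp [chainEntry, Pauli.mul, h0, h1, show j < m by omega]
  have hne : fx x y ≠ fx (sh x m) y := by
    simp [(sh_ne_self (x := x) (i := m) (by omega) (by omega)).symm]
  have h := S.sum_finset_eq B {fx x y, fx (sh x m) y, vb (sh x j) y} ?_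
  · rw [Finset.sum_insert (by simpa using hne), Finset.sum_pair (by simp)] at h
    have c1 : act (fx x y) B = act (vb (sh x j) y) (chain x (m + 1) .Z .Y y) := by
      rw [hB, act_comm, ← act_fx_chain_left, act_act]
    have c2 : act (fx (sh x m) y) B = act (vb (sh x j) y) (chain x (m + 1) .Y .Z y) := by
      rw [hB, act_comm, ← act_fx_chain_right x hm (by omega), act_act]
    have c3 : act (vb (sh x j) y) B = chain x (m + 1) .Y .Y y := by rw [hB, act_act]
    have s1 : sgn (fx x y) B = if j = 0 then 0 else -1 := by
      simp only [sgn, hBl]; split_ifs <;> rfl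
    have s2 : sgn (fx (sh x m) y) B = if j = m then 0 else -1 := by
      simp only [sgn, hBr]; split_ifs <;> rfl
    have s3 : sgn (vb (sh x j) y) B = if j = 0 ∨ j = m then -1 else 1 := by
      simp only [sgn, hBj]; rw [hB, act_vb_chain_above]; split_ifs <;> rfl
    rw [c1, c2, c3, s1, s2, s3] at h
    simp only [coupling] at h
    push_cast at h
    linear_combination h
  · intro T hs hc
    have hl : (B (x, y)).FlipsZ := by rw [hBl]; split_ifs <;> simp
    have hr : (B (sh x m, y)).FlipsZ := by rw [hBr]; split_ifs <;> simp
    by_cases h1 : (act T B (x, y)).FlipsZ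
    · by_cases h2 : (act T B (sh x m, y)).FlipsZ
      · obtain ⟨y', h⟩ := S.eq_chain_of_flipsZ_of_flipsZ hc h1 h2
        have : T = vb (sh x j) y := by
          refine eq_vb_of_act_eq_chain (by omega) (by omega) rfl ?_ ?_ ?_ h
          all_goals
            by_cases h0 : j = 0
            · simp [chainEntry, Pauli.mul, h0]
            · by_cases h1 : j = m
              · simp [chainEntry, Pauli.mul, h1, show m ≠ 0 by omega]
              · simp [chainEntry, Pauli.mul, h0, h1, show j < m by omega]
        simp [this]
      · simp [(eq_fx_of_not_flipsZ_act hs hr h2).1]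
    · simp [(eq_fx_of_not_flipsZ_act hs hl h1).1]

/-- Eliminate the decorated `Y X ⋯ X Z` between the two preceding families and replace the `Y X ⋯ X
Y` coefficient by means of `chain_ZZ_eq_shift`. -/
theorem act_vb_chain_ZY_of_chain_ZZ (y : ZMod L) {i : ℕ} (hi : i + 1 < m) : ∀ x : ZMod L,
    hx * J₁ * c (act (vb (sh x (i + 1)) y) (chain x (m + 1) .Z .Y y)) =
      2 * (i + 1) * J₂ * hx * c (chain x (m + 2) .Z .Z y) := by
  induction i with
  | zero =>
    intro x
    have e2 := S.eq_act_vb_chain_ZZ x y (j := 0) (by omega)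
    have e3 := S.eq_act_vb_chain_YY (sh x 1) y (j := 0) (by omega)
    have h1 := S.chain_ZZ_eq_shift x y
    simp only [if_true, true_or, show ¬ (0 = m) by omega, show ¬ (0 + 1 = m) by omega,
      if_false] at e2 e3
    push_cast
    linear_combination -hx * e2 - J₁ * e3 - J₂ * h1
  | succ i ih =>
    intro x
    have e2 := S.eq_act_vb_chain_ZZ x y (j := i + 1) (by omega)
    have e3 := S.eq_act_vb_chain_YY (sh x 1) y (j := i + 1) (by omega)
    have h1 := S.chain_ZZ_eq_shift x y
    have h2 := S.chain_ZZ_shift x y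
    have h3 := ih (by omega) (sh x 1)
    simp only [show ¬ (i + 1 = 0) by omega, show ¬ (i + 1 = m) by omega,
      show ¬ (i + 1 + 1 = m) by omega, or_self, if_false] at e2 e3
    push_cast
    linear_combination -hx * e2 + J₁ * e3 + h3 - J₂ * h1 + 2 * (i + 1) * J₂ * hx * h2

theorem chain_ZZ_eq_zero (x y : ZMod L) : c (chain x (m + 2) .Z .Z y) = 0 := by
  have hm := S.one_le
  obtain ⟨n, rfl⟩ : ∃ n, m = n + 1 := ⟨m - 1, by omega⟩
  have e2 := S.eq_act_vb_chain_ZZ x y (j := n) (by omega)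
  have e3 := S.eq_act_vb_chain_YY (sh x 1) y (j := n) (by omega)
  have e3' := S.eq_act_vb_chain_YY x y (j := n + 1) le_rfl
  have h1 := S.chain_ZZ_eq_shift x y
  have h1' := S.chain_ZZ_eq x y
  have h2 := S.chain_ZZ_shift x y
  -- The `m` equations for `Z X ⋯ X Z` and the `m + 1` for `Y X ⋯ X Y` contribute one `J₂ * hx`
  -- each. For `m = 1` the only interior column is both first and last, which changes the signs and
  -- leaves no recursion.
  have key : (((2 * n + 3 : ℕ) : ℂ) * (J₂ * hx)) * c (chain x (n + 1 + 2) .Z .Z y) = 0 := by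
    rcases Nat.eq_zero_or_pos n with rfl | hn
    · simp only [if_true, true_or, or_true, show ¬ ((0 : ℕ) = 0 + 1) by omega,
        show ¬ ((0 + 1 : ℕ) = 0) by omega, if_false] at e2 e3 e3'
      push_cast
      linear_combination hx * e2 + J₁ * e3 + J₁ * e3' + J₂ * h1 + J₂ * h1'
    · obtain ⟨l, rfl⟩ : ∃ l, n = l + 1 := ⟨n - 1, by omega⟩
      have h3 := S.act_vb_chain_ZY_of_chain_ZZ y (i := l) (by omega) (sh x 1)
      simp only [show ¬ (l + 1 = 0) by omega, show ¬ (l + 1 = l + 1 + 1) by omega,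
        show ¬ (l + 1 + 1 = 0) by omega, or_self, or_true, if_true, if_false] at e2 e3 e3'
      push_cast
      linear_combination hx * e2 - J₁ * e3 + J₁ * e3' - h3 + J₂ * h1 + J₂ * h1' -
        2 * (l + 1) * J₂ * hx * h2
  refine (mul_eq_zero.1 key).resolve_left (mul_ne_zero ?_ (mul_ne_zero S.J₂_ne S.hx_ne))
  exact_mod_cast (show 2 * n + 3 ≠ 0 by omega)

/-- No product of maximal width contributes to a solution. -/
theorem eq_zero_of_occupied {A : PauliProduct L} {x : ZMod L}
    (hl : Occupied A x) (hr : Occupied A (sh x (m + 1))) : c A = 0 := by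
  by_contra hA
  obtain ⟨y, rfl⟩ := S.eq_chain hA hl hr
  exact hA (S.chain_ZZ_eq_zero x y)

end IsSolution

end

/-! ### From operators to the linear system for the coefficients -/

namespace Pauli

/-- The phase in the product of two single-site operators. -/
noncomputable def phase : Pauli → Pauli → ℂ
  | .X, .Y => Complex.I
  | .Y, .Z => Complex.I
  | .Z, .X => Complex.I
  | .Y, .X => -Complex.I
  | .Z, .Y => -Complex.I
  | .X, .Z => -Complex.I
  | _, _ => 1

theorem mul_comm (p q : Pauli) : mul p q = mul q p := by cases p <;> cases q <;> rfl

theorem pauliMatrix_mul (p q : Pauli) :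
    pauliMatrix p * pauliMatrix q = phase p q • pauliMatrix (mul p q) := by
  cases p <;> cases q <;> ext i j <;> fin_cases i <;> fin_cases j <;>
    simp [pauliMatrix, phase, mul, Matrix.mul_apply, Fin.sum_univ_two]

theorem trace_mul (p q : Pauli) :
    (pauliMatrix p * pauliMatrix q).trace = if p = q then 2 else 0 := by
  cases p <;> cases q <;>
    simp [pauliMatrix, Matrix.trace, Fin.sum_univ_two, one_add_one_eq_two]

@[simp] theorem phase_I_left (p : Pauli) : phase .I p = 1 := by cases p <;> rfl

@[simp] theorem phase_I_right (p : Pauli) : phase p .I = 1 := by cases p <;> rfl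

end Pauli

section
variable {L : ℕ} [NeZero L]

theorem toOperator_mul_apply (A B : PauliProduct L) (s u : Site L → Fin 2) :
    (A.toOperator * B.toOperator) s u =
      ∏ r, (pauliMatrix (A r) * pauliMatrix (B r)) (s r) (u r) := by
  simp only [Matrix.mul_apply, PauliProduct.toOperator, Matrix.of_apply]
  rw [Fintype.prod_sum]
  exact Finset.sum_congr rfl fun t _ => Finset.prod_mul_distrib.symm

theorem toOperator_mul (A B : PauliProduct L) : A.toOperator * B.toOperator =
    (∏ r, Pauli.phase (A r) (B r)) • PauliProduct.toOperator fun r => Pauli.mul (A r) (B r) := by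
  ext s u
  rw [toOperator_mul_apply, Matrix.smul_apply, PauliProduct.toOperator, Matrix.of_apply,
    smul_eq_mul, ← Finset.prod_mul_distrib]
  refine Finset.prod_congr rfl fun r _ => ?_
  rw [Pauli.pauliMatrix_mul, Matrix.smul_apply, smul_eq_mul]

/-- The trace factorizes over sites. This orthogonality makes the Pauli products linearly
independent. -/
theorem trace_toOperator_mul (A B : PauliProduct L) :
    (A.toOperator * B.toOperator).trace = if A = B then 2 ^ Fintype.card (Site L) else 0 := by
  have h : (A.toOperator * B.toOperator).trace =
      ∏ r, (pauliMatrix (A r) * pauliMatrix (B r)).trace := by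
    simp only [Matrix.trace, Matrix.diag_apply, toOperator_mul_apply]
    rw [Fintype.prod_sum]
  rw [h]
  simp only [Pauli.trace_mul]
  split_ifs with hAB
  · subst hAB; simp
  · obtain ⟨r, hr⟩ := Function.ne_iff.1 hAB
    exact Finset.prod_eq_zero (Finset.mem_univ r) (if_neg hr)

theorem eq_zero_of_sum_toOperator_eq_zero {d : PauliProduct L → ℂ}
    (h : ∑ A, d A • A.toOperator = 0) (B : PauliProduct L) : d B = 0 := by
  have h1 : ((∑ A, d A • A.toOperator) * B.toOperator).trace = 0 := by
    rw [h, zero_mul, Matrix.trace_zero]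
  simp only [Finset.sum_mul, Matrix.smul_mul, Matrix.trace_sum, Matrix.trace_smul,
    trace_toOperator_mul, smul_eq_mul, mul_ite, mul_zero, Finset.sum_ite_eq', Finset.mem_univ,
    if_true] at h1
  exact (mul_eq_zero.1 h1).resolve_right (pow_ne_zero _ two_ne_zero)

theorem siteOp_eq (P : Pauli) (r : Site L) :
    siteOp P r = PauliProduct.toOperator fun s => if s = r then P else .I := by
  unfold siteOp
  congr 1
  funext s
  simp [Function.update_apply]

theorem siteOp_Z_mul_siteOp_Z {r r' : Site L} (h : r ≠ r') : siteOp .Z r * siteOp .Z r' =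
    PauliProduct.toOperator fun s => if s = r ∨ s = r' then .Z else .I := by
  rw [siteOp_eq, siteOp_eq, toOperator_mul, Finset.prod_eq_one, one_smul]
  · congr 1
    funext s
    by_cases h1 : s = r
    · subst h1; simp [h, Pauli.mul]
    · simp [h1]
  · intro s _
    split_ifs <;> simp [Pauli.phase]

theorem sum_term (f : Term L → Operator L) : ∑ T, f T =
    ∑ r, (f (.hbond, r) + f (.vbond, r) + f (.xfield, r) + f (.zfield, r)) := by
  rw [Fintype.sum_prod_type_right]
  refine Finset.sum_congr rfl fun r _ => ?_
  rw [show (Finset.univ : Finset TermKind) = {.hbond, .vbond, .xfield, .zfield} from rfl,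
    Finset.sum_insert (by decide), Finset.sum_insert (by decide), Finset.sum_pair (by decide)]
  simp only [add_assoc]

theorem hamiltonian_eq [Fact (1 < L)] (J₁ J₂ hx hz : ℝ) : hamiltonian L J₁ J₂ hx hz =
    ∑ T : Term L, coupling J₁ J₂ hx hz T.1 • PauliProduct.toOperator T.string := by
  rw [sum_term, hamiltonian]
  refine Finset.sum_congr rfl fun r _ => ?_
  have h1 : r + e₁ L = (r.1 + 1, r.2) := by ext <;> simp [e₁]
  have h2 : r + e₂ L = (r.1, r.2 + 1) := by ext <;> simp [e₂]
  rw [h1, h2, siteOp_Z_mul_siteOp_Z (by simp [Prod.ext_iff]),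
    siteOp_Z_mul_siteOp_Z (by simp [Prod.ext_iff]), siteOp_eq, siteOp_eq]
  rfl

theorem prod_eq_of_pair {r r' : Site L} (h : r ≠ r') {f : Site L → ℂ}
    (hf : ∀ s, s ≠ r → s ≠ r' → f s = 1) : ∏ s, f s = f r * f r' := by
  rw [← Finset.prod_pair h]
  refine (Finset.prod_subset (Finset.subset_univ _) fun s _ hs => ?_).symm
  simp only [Finset.mem_insert, Finset.mem_singleton, not_or] at hs
  exact hf s hs.1 hs.2

theorem prod_phase_sub_of_bond {r r' : Site L} (h : r ≠ r') (B : PauliProduct L) {T : PauliProduct L}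
    (hT : T = fun s => if s = r ∨ s = r' then .Z else .I) :
    ∏ s, Pauli.phase (T s) (Pauli.mul (T s) (B s)) -
      ∏ s, Pauli.phase (Pauli.mul (T s) (B s)) (T s) =
        2 * Complex.I * Pauli.sgnZZ (B r) (B r') := by
  subst hT
  rw [prod_eq_of_pair h (fun s h1 h2 => by simp [h1, h2]),
    prod_eq_of_pair h (fun s h1 h2 => by simp [h1, h2])]
  simp only [true_or, or_true, if_true]
  generalize B r = b
  generalize B r' = b'
  cases b <;> cases b' <;> simp [Pauli.phase, Pauli.mul, Pauli.sgnZZ, Pauli.sgnZ] <;> ring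

theorem prod_phase_sub [Fact (1 < L)] (T : Term L) (B : PauliProduct L) :
    ∏ s, Pauli.phase (T.string s) (act T B s) - ∏ s, Pauli.phase (act T B s) (T.string s) =
      2 * Complex.I * sgn T B := by
  obtain ⟨kd, r⟩ := T
  cases kd
  · exact prod_phase_sub_of_bond (r := r) (r' := (r.1 + 1, r.2)) (by simp [Prod.ext_iff]) B rfl
  · exact prod_phase_sub_of_bond (r := r) (r' := (r.1, r.2 + 1)) (by simp [Prod.ext_iff]) B rfl
  all_goals
    rw [Fintype.prod_eq_single r fun s hs => by simp [Term.string, hs],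
      Fintype.prod_eq_single r fun s hs => by simp [Term.string, hs]]
    simp only [act, Term.string, sgn, if_true]
    generalize B r = b
    cases b <;> simp [Pauli.phase, Pauli.mul, Pauli.sgnX, Pauli.sgnZ] <;> ring

theorem string_commutator [Fact (1 < L)] (T : Term L) (A : PauliProduct L) :
    PauliProduct.toOperator T.string * A.toOperator - A.toOperator * PauliProduct.toOperator T.string =
      (2 * Complex.I * sgn T (act T A)) • (act T A).toOperator := by
  rw [toOperator_mul, toOperator_mul, ← prod_phase_sub T (act T A), act_act, sub_smul]
  simp only [Pauli.mul_comm (A _)]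
  rfl

theorem sum_eq_zero_of_commute [Fact (1 < L)] {J₁ J₂ hx hz : ℝ} {c : PauliProduct L → ℂ}
    (h : Commute (∑ A, c A • A.toOperator) (hamiltonian L J₁ J₂ hx hz)) (B : PauliProduct L) :
    ∑ T : Term L, coupling J₁ J₂ hx hz T.1 * sgn T B * c (act T B) = 0 := by
  have key : ∑ B : PauliProduct L, (∑ T : Term L, 2 * Complex.I *
      (coupling J₁ J₂ hx hz T.1 * sgn T B * c (act T B))) • B.toOperator = 0 := by
    have h0 := sub_eq_zero.2 h.eq.symm
    rw [hamiltonian_eq, Finset.sum_mul_sum, Finset.sum_mul_sum, Finset.sum_comm,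
      ← Finset.sum_sub_distrib] at h0
    simp_rw [← Finset.sum_sub_distrib] at h0
    rw [Finset.sum_comm] at h0
    rw [← h0]
    simp only [Finset.sum_smul]
    rw [Finset.sum_comm]
    refine Finset.sum_congr rfl fun T _ => ?_
    -- For fixed `T`, substitute `B = act T A`, the product to which `A` contributes.
    refine (Equiv.sum_comp (Function.Involutive.toPerm (act T) (act_act T)) _).symm.trans ?_
    refine Finset.sum_congr rfl fun A _ => ?_
    change (2 * Complex.I * (_ * (sgn T (act T A) : ℂ) * c (act T (act T A)))) • (act T A).toOperator = _
    rw [act_act, smul_mul_smul_comm, smul_mul_smul_comm, mul_comm (c A), ← smul_sub, string_commutator,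
      smul_smul]
    congr 1
    ring
  have h1 := eq_zero_of_sum_toOperator_eq_zero key B
  rw [← Finset.mul_sum] at h1
  exact (mul_eq_zero.1 h1).resolve_left (mul_ne_zero two_ne_zero Complex.I_ne_zero)

omit [NeZero L] in
theorem rectangle_subset {r : Site L} {l₁ l₂ k₁ : ℕ} (h : l₁ ≤ k₁) :
    rectangle r l₁ l₂ ⊆ rectangle r k₁ l₂ := by
  rintro p ⟨⟨i, hi, hp⟩, hq⟩
  exact ⟨⟨i, hi.trans_le h, hp⟩, hq⟩

/-- The conditions on the two coordinates are independent, so both side lengths can be minimized at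
once. -/
theorem exists_hasSupportSize (A : PauliProduct L) : ∃ l₁ l₂, A.HasSupportSize l₁ l₂ := by
  classical
  have h1 : ∃ n, ∃ x : ZMod L, ∀ p ∈ A.support, ∃ i : ℕ, i < n ∧ p.1 = x + (i : ZMod L) :=
    ⟨L, 0, fun p _ => ⟨p.1.val, ZMod.val_lt _, by simp⟩⟩
  have h2 : ∃ n, ∃ x : ZMod L, ∀ p ∈ A.support, ∃ i : ℕ, i < n ∧ p.2 = x + (i : ZMod L) :=
    ⟨L, 0, fun p _ => ⟨p.2.val, ZMod.val_lt _, by simp⟩⟩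
  obtain ⟨x₁, hx₁⟩ := Nat.find_spec h1
  obtain ⟨x₂, hx₂⟩ := Nat.find_spec h2
  refine ⟨Nat.find h1, Nat.find h2, ⟨(x₁, x₂), fun p hp => ⟨hx₁ p hp, hx₂ p hp⟩⟩,
    fun r m₁ m₂ h => ⟨Nat.find_min' h1 ⟨r.1, fun p hp => (h hp).1⟩,
      Nat.find_min' h2 ⟨r.2, fun p hp => (h hp).2⟩⟩⟩

-- If the first or last column of a minimal rectangle were empty, the rectangle could be shortened.
omit [NeZero L] in
theorem PauliProduct.HasSupportSize.exists_occupied {A : PauliProduct L} {n l₂ : ℕ}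
    (h : A.HasSupportSize (n + 1) l₂) :
    ∃ x, Occupied A x ∧ Occupied A (sh x n) := by
  obtain ⟨⟨r, hr⟩, hmin⟩ := h
  refine ⟨r.1, ?_, ?_⟩
  · by_contra hn
    have : A.support ⊆ rectangle (r.1 + 1, r.2) n l₂ := by
      intro p hp
      obtain ⟨⟨i, hi, hpi⟩, hq⟩ := hr hp
      refine ⟨⟨i - 1, ?_⟩, hq⟩
      rcases i with _ | i
      · exact absurd ⟨p.2, by rw [show r.1 = p.1 by simpa using hpi.symm]; exact hp⟩ hn
      · exact ⟨by omega, by rw [hpi]; push_cast; ring⟩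
    exact absurd (hmin _ _ _ this).1 (by omega)
  · by_contra hn
    have : A.support ⊆ rectangle r n l₂ := by
      intro p hp
      obtain ⟨⟨i, hi, hpi⟩, hq⟩ := hr hp
      refine ⟨⟨i, ?_, hpi⟩, hq⟩
      by_contra hlt
      obtain rfl : i = n := by omega
      exact hn ⟨p.2, by rw [show sh r.1 i = p.1 from hpi.symm]; exact hp⟩
    exact absurd (hmin _ _ _ this).1 (by omega)

end

end IsingSquare

theorem theorem1 (L : ℕ) [NeZero L] (J₁ J₂ hx hz : ℝ)
    (hJ₁ : J₁ ≠ 0) (hJ₂ : J₂ ≠ 0) (hhx : hx ≠ 0)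
    (k₁ k₂ : ℕ) (hk₁ : 3 ≤ k₁) (hk₁L : (k₁ : ℝ) ≤ (L : ℝ) / 2) :
    ¬ ∃ Q : IsingSquare.Operator L,
      IsingSquare.IsLocalConservedQuantity
        (IsingSquare.hamiltonian L J₁ J₂ hx hz) k₁ k₂ Q := by
  rintro ⟨Q, hcomm, c, rfl, ⟨⟨A, l₂, hA, hsize⟩, hmax⟩, -⟩
  obtain ⟨m, rfl⟩ : ∃ m, k₁ = m + 2 := ⟨k₁ - 2, by omega⟩
  have hL : 2 * (m + 2) ≤ L := by
    have : (2 : ℝ) * ((m + 2 : ℕ) : ℝ) ≤ L := by linarith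
    exact_mod_cast this
  have : Fact (1 < L) := ⟨by omega⟩
  have S : IsingSquare.IsSolution m (J₁ : ℂ) J₂ hx hz c :=
    { one_le := by omega
      le_size := hL
      J₁_ne := by exact_mod_cast hJ₁
      J₂_ne := by exact_mod_cast hJ₂
      hx_ne := by exact_mod_cast hhx
      sum_eq := IsingSquare.sum_eq_zero_of_commute hcomm
      -- Every product with nonzero coefficient has some support size, bounded by the maximality of
      -- `k₁`.
      window := by
        intro A hA
        obtain ⟨l₁, l₂, h⟩ := IsingSquare.exists_hasSupportSize A
        have hl : l₁ ≤ m + 2 := hmax ⟨A, l₂, hA, h⟩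
        obtain ⟨r, hr⟩ := h.1
        exact ⟨r.1, fun p y hp => ((hr.trans (IsingSquare.rectangle_subset hl)) hp).1⟩ }
  obtain ⟨x, hl, hr⟩ := hsize.exists_occupied
  exact hA (S.eq_zero_of_occupied hl hr)
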